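/- **Setting.** Let $p$ be a seminorm on $\mathbb{R}^d$, $E=\{x: p(x)=0\}$, and let $N\ge 1$ be the number of agents. For each $i\in\{1,\dots,N\}$ let $(y^i_t)_{t\ge 0}$ be a time-homogeneous Markov chain on a common measurable space $\mathcal{Y}$ with unique stationary distribution $\eta_i$, the $N$ chains being independent of each other. Let $h_i:\mathbb{R}^d\times\mathcal{Y}\to\mathbb{R}^d$ be such that $h_i(Q,\cdot)$ is $\eta_i$-integrable for all $Q$, and suppose that $H(Q)=\frac1N\sum_i \mathbb{E}_{y\sim\eta_i}h_i(Q,y)$ satisfies $p(H(x)-H(x'))\le\beta\,p(x-x')$ for all $x,x'$, where $\beta\in[0,1)$. Let $Q^*$ satisfy $H(Q^*)-Q^*\in E$. Let $\alpha\in(1/2,1)$, $\alpha_t=1/(t+1)^\alpha$, let $Q_0$ be a random vector with $\mathbb{E}\,p(Q_0-Q^*)<\infty$, and $$Q_{t+1}=Q_t+\alpha_t\Big[\tfrac1N\sum_{i=1}^N h_i(Q_t,y^i_t)-Q_t\Big],\qquad \bar Q_{t+1}=\bar Q_t+\tfrac1{t+1}[Q_t-\bar Q_t],\qquad t\ge 0,$$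 so that $\bar Q_T=\frac1T\sum_{t<T}Q_t$. Let $\mathcal{F}_t$ be the $\sigma$-field generated by $Q_0$ and all $y^i_k$ with $k<t$. For $\rho\in(0,1)$ put $\tau_t=\min\{\tau>0:\rho^\tau\le\alpha_t^2\}$ and $t_*=\min\{t>0: t\ge 2\tau_t\}$. **Assumptions**, with constants $C_A,C_b,C_*,C_E,C_Q>0$ and $\rho\in(0,1)$: * (A1) For each $i$ there are measurable $b_i:\mathbb{R}^d\times\mathcal{Y}\to\mathbb{R}^d$ and $A_i:\mathbb{R}^d\times\mathcal{Y}\to\mathbb{R}^{d\times d}$ with $h_i(Q,y)=b_i(Q,y)+A_i(Q,y)Q$, such that for all $Q,Q',y$: (a) $A_i(Q,y)e=e$ for $e\in E$; (b) $A_i(Q,y)Q\ge A_i(Q',y)Q$ coordinatewise; (c) $p(A_i(Q,y)x)\le C_A\,p(x)$ for all $x$, and $p(b_i(Q,y))\le C_b$; (d) for every $Q^\circ$ with $H(Q^\circ)-Q^\circ\in E$, $p(Q-Q^\circ)<C_*$ implies $A_i(Q,y)=A_i(Q^\circ,y)$ and $b_i(Q,y)=b_i(Q^\circ,y)$. * (A2)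 For every agent $i$ and all $0\le\tau<t$, almost surely $\|\mathbb{P}(y^i_t=\cdot\mid\mathcal{F}_{t-\tau})-\eta_i\|_{\mathrm{TV}}\le C_E\,\rho^\tau$. (It is enough that for each measurable $B$, almost surely $|\mathbb{P}(y^i_t\in B\mid\mathcal{F}_{t-\tau})-\eta_i(B)|\le C_E\,\rho^\tau$.) * (A3) There is a norm $\|\cdot\|$ on $\mathbb{R}^d$ with $p(Q)=\min_{e\in E}\|Q-e\|$ for all $Q$ that is monotone: $0\le x\le x'$ coordinatewise implies $\|x\|\le\|x'\|$. * (A4) $\mathbb{E}\,p(Q_t-Q^*)^2\le C_Q\,\tau_t\,\alpha_t$ for all $t>t_*$. **Conclusion.** $\tau_T=O(\log T)$ as $T\to\infty$, and for all $T>t_*$ the variable $p(\bar Q_T-Q^*)$ is integrable with $$\mathbb{E}\,p(\bar Q_T-Q^*)\le\frac{C^{(1)}\sqrt{\tau_T}}{\sqrt{NT}}+\frac{C^{(2)}\ln T}{T^\alpha}.$$ Here $C^{(1)}$ depends only on $d,\alpha,\rho,\beta,C_E,C_A,C_b$ and an upper bound on $p(Q^*)$, and $C^{(2)}$ only on these,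 on $C_*,C_Q$ and on an upper bound on $\mathbb{E}\,p(Q_0-Q^*)$; in particular neither depends on $T$, on $N$, on $p$, on the functions $h_i$ or on the chains. -/

import Mathlib

open MeasureTheory ProbabilityTheory

namespace FixedPointSA

noncomputable section

/-- The stepsize `α_t = 1 / (t + 1) ^ α`. -/
def stepsize (α : ℝ) (t : ℕ) : ℝ := 1 / ((t : ℝ) + 1) ^ α

/-- `τ_t = min {τ > 0 : ρ ^ τ ≤ α_t ^ 2}`. -/
def mixTime (ρ α : ℝ) (t : ℕ) : ℕ := sInf {τ : ℕ | 0 < τ ∧ ρ ^ τ ≤ stepsize α t ^ 2}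

/-- `t_* = min {t > 0 : t ≥ 2 τ_t}`. -/
def burnIn (ρ α : ℝ) : ℕ := sInf {t : ℕ | 0 < t ∧ 2 * mixTime ρ α t ≤ t}

/-- The averaged mean operator `H(Q) = (1/N) ∑ i, E_{y ∼ η_i} h_i(Q, y)`. -/
def meanOp {d N : ℕ} {Y : Type*} [MeasurableSpace Y]
    (h : Fin N → (Fin d → ℝ) → Y → (Fin d → ℝ)) (η : Fin N → Measure Y)
    (Q : Fin d → ℝ) : Fin d → ℝ :=
  (1 / (N : ℝ)) • ∑ i, ∫ y, h i Q y ∂(η i)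

/-- `H(Q) - Q` lies in the subspace `E = {x | p x = 0}`. -/
def IsSeminormFixedPoint {d : ℕ} (p : Seminorm ℝ (Fin d → ℝ))
    (H : (Fin d → ℝ) → (Fin d → ℝ)) (Q : Fin d → ℝ) : Prop :=
  p (H Q - Q) = 0

/-- The iterates `Q_{t+1} = Q_t + α_t [(1/N) ∑ i, h_i(Q_t, y^i_t) - Q_t]`. -/
def iterate {d N : ℕ} {Ω Y : Type*}
    (h : Fin N → (Fin d → ℝ) → Y → (Fin d → ℝ)) (α : ℝ)
    (Q₀ : Ω → (Fin d → ℝ)) (y : Fin N → ℕ → Ω → Y) : ℕ → Ω → (Fin d → ℝ)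
  | 0, ω => Q₀ ω
  | t + 1, ω =>
      iterate h α Q₀ y t ω + stepsize α t •
        ((1 / (N : ℝ)) • (∑ i, h i (iterate h α Q₀ y t ω) (y i t ω)) - iterate h α Q₀ y t ω)

/-- The running average `Qbar_{t+1} = Qbar_t + (Q_t - Qbar_t) / (t + 1)`. The value at time `0` is
immaterial, since the first step overwrites it: `Qbar_1 = Q_0`. -/
def runningAverage {d : ℕ} {Ω : Type*} (Q : ℕ → Ω → (Fin d → ℝ)) : ℕ → Ω → (Fin d → ℝ)
  | 0, _ => 0
  | t + 1, ω =>
      runningAverage Q t ω + (1 / ((t : ℝ) + 1)) • (Q t ω - runningAverage Q t ω)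

/-- The sigma-field `F_t` generated by `Q_0` and by `y^i_k` for all agents `i` and all `k < t`. -/
@[reducible] def history {d N : ℕ} {Ω Y : Type*} [MeasurableSpace Y]
    (Q₀ : Ω → (Fin d → ℝ)) (y : Fin N → ℕ → Ω → Y) (t : ℕ) : MeasurableSpace Ω :=
  MeasurableSpace.comap Q₀ inferInstance ⊔
    ⨆ (i : Fin N) (k : ℕ) (_ : k < t), MeasurableSpace.comap (y i k) inferInstance

/-- `y` is a (time-homogeneous) Markov chain with transition kernel `κ`. -/
def IsMarkovChain {Ω Y : Type*} [MeasurableSpace Ω] [MeasurableSpace Y]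
    (μ : Measure Ω) (y : ℕ → Ω → Y) (κ : Kernel Y Y) : Prop :=
  (∀ t, Measurable (y t)) ∧
  ∀ (t : ℕ) (B : Set Y), MeasurableSet B →
    μ[(y (t + 1) ⁻¹' B).indicator (fun _ => (1 : ℝ)) |
        ⨆ (k : ℕ) (_ : k ≤ t), MeasurableSpace.comap (y k) inferInstance]
      =ᵐ[μ] fun ω => (κ (y t ω)).real B

/-- `η` is the unique stationary distribution of the kernel `κ`. -/
def IsUniqueStationary {Y : Type*} [MeasurableSpace Y] (κ : Kernel Y Y) (η : Measure Y) : Prop :=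
  IsProbabilityMeasure η ∧ κ.Invariant η ∧
  ∀ ν : Measure Y, IsProbabilityMeasure ν → κ.Invariant ν → ν = η

/-- Piecewise-linear local update functions. The bound on the matrix seminorm,
`p(A) = sup {p (A x) : p x ≤ 1} ≤ C_A`, is written as `p (A x) ≤ C_A p x` for all `x`. -/
def PiecewiseLinear {d N : ℕ} {Y : Type*} [MeasurableSpace Y] (p : Seminorm ℝ (Fin d → ℝ))
    (h : Fin N → (Fin d → ℝ) → Y → (Fin d → ℝ)) (η : Fin N → Measure Y)
    (C_A C_b C_s : ℝ) : Prop :=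
  ∀ i : Fin N, ∃ (b : (Fin d → ℝ) → Y → (Fin d → ℝ))
    (A : (Fin d → ℝ) → Y → Matrix (Fin d) (Fin d) ℝ),
    Measurable (fun z : (Fin d → ℝ) × Y => b z.1 z.2) ∧
    (∀ j k, Measurable (fun z : (Fin d → ℝ) × Y => A z.1 z.2 j k)) ∧
    (∀ Q y, h i Q y = b Q y + (A Q y).mulVec Q) ∧
    (∀ Q y e, p e = 0 → (A Q y).mulVec e = e) ∧
    (∀ Q Q' y, (A Q' y).mulVec Q ≤ (A Q y).mulVec Q) ∧
    (∀ Q y, (∀ x, p ((A Q y).mulVec x) ≤ C_A * p x) ∧ p (b Q y) ≤ C_b) ∧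
    (∀ Qf, IsSeminormFixedPoint p (meanOp h η) Qf →
      ∀ Q y, p (Q - Qf) < C_s → A Q y = A Qf y ∧ b Q y = b Qf y)

/-- Geometric mixing: for `0 ≤ τ < t`, the conditional law of `y^i_t` given `F_{t-τ}` is within
`C_E ρ ^ τ` of `η_i` in total variation `sup_B |P(y^i_t ∈ B | F_{t-τ}) - η_i(B)|`. The almost sure
bound is imposed event by event, so that no regular version of the conditional law is needed. -/
def GeometricMixing {d N : ℕ} {Ω Y : Type*} [MeasurableSpace Ω] [MeasurableSpace Y]
    (μ : Measure Ω) (Q₀ : Ω → (Fin d → ℝ)) (y : Fin N → ℕ → Ω → Y) (η : Fin N → Measure Y)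
    (C_E ρ : ℝ) : Prop :=
  ∀ (i : Fin N) (t τ : ℕ), τ < t → ∀ B : Set Y, MeasurableSet B →
    ∀ᵐ ω ∂μ, |(μ[(y i t ⁻¹' B).indicator (fun _ => (1 : ℝ)) | history Q₀ y (t - τ)]) ω
        - (η i).real B| ≤ C_E * ρ ^ τ

/-- There is a norm `n` inducing `p`, i.e. `p Q = min {n (Q - e) : p e = 0}` for all `Q`, which is
monotone: `0 ≤ x ≤ x'` implies `n x ≤ n x'`. -/
def HasMonotoneInducedNorm {d : ℕ} (p : Seminorm ℝ (Fin d → ℝ)) : Prop :=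
  ∃ n : Seminorm ℝ (Fin d → ℝ), (∀ x, n x = 0 → x = 0) ∧
    (∀ Q, IsLeast {r : ℝ | ∃ e, p e = 0 ∧ r = n (Q - e)} (p Q)) ∧
    (∀ x x' : Fin d → ℝ, 0 ≤ x → x ≤ x' → n x ≤ n x')

/-- Rate of the raw iterates in mean square: `E p(Q_t - Qs)^2 ≤ C_Q τ_t α_t` for `t > t_*`. -/
def RawIterateRate {d : ℕ} {Ω : Type*} [MeasurableSpace Ω] (μ : Measure Ω)
    (p : Seminorm ℝ (Fin d → ℝ)) (Q : ℕ → Ω → (Fin d → ℝ)) (Qs : Fin d → ℝ)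
    (ρ α C_Q : ℝ) : Prop :=
  ∀ t : ℕ, burnIn ρ α < t →
    Integrable (fun ω => p (Q t ω - Qs) ^ 2) μ ∧
    ∫ ω, p (Q t ω - Qs) ^ 2 ∂μ ≤ C_Q * (mixTime ρ α t : ℝ) * stepsize α t

end

end FixedPointSA

/-! Put $\Delta_t=Q_t-Q^*$. Near $Q^*$ the pieces are constant, so the recursion there is linear
with random matrices $A_i(Q^*,y)$. The averaged mean $G$ of these matrices inherits the contraction
factor $\beta$ of $H$. Hence $\Delta_{t+1}=\Delta_t-\alpha_t(\Delta_t-G\Delta_t)+\alpha_t n_t$,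
where $n_t$ is a sum of an additive noise $\xi_t$ at $Q^*$, a multiplicative noise linear in
$\Delta_t$, a remainder of linearization, and an element of $E$, which $p$ ignores.

Summing backwards gives $\sum_{t<T}\Delta_t=L_0\Delta_0+\sum_{s<T}\alpha_sL_{s+1}n_s$ with
deterministic linear maps $L_s$ (`exists_backward_maps`, `sum_eq_of_backward_maps`). A scalar
supersolution of order $1/\alpha_s$ (`exists_backward_weight`) bounds $\alpha_sL_{s+1}$ by a
constant $K$ free of $T$. Each noise term is then estimated with $\tau=\tau_T$, for which
$T\rho^{\tau}\le1$.

The additive noise is tested against deterministic maps, so the contributions of different agents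
stay independent. Their average has variance of order $\tau T/N$ and bias of order $\tau$
(`integral_abs_average_le_of_mixing`), which yields the leading term.

In the multiplicative noise, $\Delta_s$ is correlated with $y^i_s$. It is replaced by
$\Delta_{s-\tau}$, at a cost of order $\tau\sum\alpha_s$ apart from initial terms. With lagged
weights, mixing makes products at times more than $\tau$ apart nearly uncorrelated
(`integral_sq_sum_le_of_mixing`), and (A4) bounds the second moment by a multiple of
$\tau\cdot\tau\sum\alpha_s$.

The remainder vanishes in the ball of radius $C_*$ and grows linearly, hence is at most quadratic in
$p(\Delta_s)$; by (A4) its sum is of order $\tau\sum\alpha_s$ after the burn-in.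

Since $\sum_{s<T}\alpha_s$ is of order $T^{1-\alpha}$ and $\tau$ of order $\log T$, division by $T$
turns everything except the leading term into $\log T/T^\alpha$. Seminorms are reduced to scalar
functionals by coordinates whose constants depend on $d$ only (`exists_seminorm_coordinates`). -/

namespace FixedPointSA

/-! ### Step sizes, mixing time, burn-in and the backward weight. -/

section StepSizes

variable {α ρ : ℝ}

lemma stepsize_pos (α : ℝ) (t : ℕ) : 0 < stepsize α t := by
  unfold stepsize; positivity

lemma stepsize_antitone (hα : 0 ≤ α) : Antitone (stepsize α) := by
  intro s t hst
  unfold stepsize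
  have : (s : ℝ) ≤ t := by exact_mod_cast hst
  gcongr

lemma stepsize_le_one (hα : 0 ≤ α) (t : ℕ) : stepsize α t ≤ 1 := by
  have := stepsize_antitone hα (Nat.zero_le t)
  simpa [stepsize] using this

/-- This is where $\alpha\ge1/2$ enters: the definition of $\tau_T$ gives
$\rho^{\tau_T}\le\alpha_T^2$, so the mixing errors of $T$ time steps add up to at most a constant.
-/
lemma mul_stepsize_sq_le_one (hα : 1 / 2 ≤ α) (t : ℕ) : (t : ℝ) * stepsize α t ^ 2 ≤ 1 := by
  unfold stepsize
  have h1 : (1 : ℝ) ≤ (t : ℝ) + 1 := by linarith [(Nat.cast_nonneg t : (0 : ℝ) ≤ t)]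
  have h2 : (t : ℝ) + 1 ≤ (((t : ℝ) + 1) ^ α) ^ 2 := by
    rw [← Real.rpow_natCast, ← Real.rpow_mul (by positivity)]
    calc (t : ℝ) + 1 = ((t : ℝ) + 1) ^ (1 : ℝ) := by simp
      _ ≤ _ := Real.rpow_le_rpow_of_exponent_le h1 (by push_cast; linarith)
  rw [div_pow, one_pow, mul_one_div, div_le_one (by positivity)]
  linarith

lemma sum_stepsize_le (hα : α ∈ Set.Ioo (1 / 2 : ℝ) 1) (T : ℕ) :
    ∑ r ∈ Finset.range T, stepsize α r ≤ (T : ℝ) ^ (1 - α) / (1 - α) := by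
  obtain ⟨h1, h2⟩ := hα
  have hc : 0 < 1 - α := by linarith
  induction T with
  | zero => simp [Real.zero_rpow hc.ne']
  | succ T ih =>
    rw [Finset.sum_range_succ]
    refine (add_le_add_left ih _).trans ?_
    rw [le_div_iff₀ hc, add_mul, div_mul_cancel₀ _ hc.ne']
    push_cast
    have hT : (0 : ℝ) < (T : ℝ) + 1 := by positivity
    -- Bernoulli's inequality for the concave power $1-\alpha$; multiplied by $(T+1)^{1-\alpha}$ it
    -- reads $(1-\alpha)\alpha_T\le(T+1)^{1-\alpha}-T^{1-\alpha}$.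
    have hb : (1 + (-(1 / ((T : ℝ) + 1)))) ^ (1 - α) ≤ 1 + (1 - α) * (-(1 / ((T : ℝ) + 1))) := by
      refine rpow_one_add_le_one_add_mul_self ?_ hc.le (by linarith)
      rw [neg_le_neg_iff, div_le_one hT]; linarith [(Nat.cast_nonneg T : (0 : ℝ) ≤ T)]
    have e1 : (1 + (-(1 / ((T : ℝ) + 1)))) = T / (T + 1) := by field_simp; ring
    rw [e1, Real.div_rpow (by positivity) hT.le, div_le_iff₀ (by positivity)] at hb
    have e2 : stepsize α T = ((T : ℝ) + 1) ^ (1 - α) * (1 / (T + 1)) := by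
      unfold stepsize
      rw [Real.rpow_sub hT, Real.rpow_one]; field_simp
    rw [e2]; linarith

lemma exists_pow_le_stepsize_sq (hρ : ρ ∈ Set.Ioo (0 : ℝ) 1) (t : ℕ) (k : ℕ)
    (hk : 2 * α * Real.log (t + 1) / (-Real.log ρ) ≤ k) : ρ ^ k ≤ stepsize α t ^ 2 := by
  obtain ⟨h0, h1⟩ := hρ
  have hl : 0 < -Real.log ρ := by linarith [Real.log_neg h0 h1]
  have ht : (0 : ℝ) < (t : ℝ) + 1 := by positivity
  rw [← Real.log_le_log_iff (by positivity) (by have := stepsize_pos α t; positivity)]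
  rw [Real.log_pow, Real.log_pow, stepsize, Real.log_div one_ne_zero (by positivity),
    Real.log_rpow ht, Real.log_one]
  rw [div_le_iff₀ hl] at hk
  push_cast; linarith

lemma mixTime_spec (hρ : ρ ∈ Set.Ioo (0 : ℝ) 1) (t : ℕ) :
    0 < mixTime ρ α t ∧ ρ ^ mixTime ρ α t ≤ stepsize α t ^ 2 := by
  refine Nat.sInf_mem (s := {τ : ℕ | 0 < τ ∧ ρ ^ τ ≤ stepsize α t ^ 2}) ?_
  refine ⟨⌈2 * α * Real.log (t + 1) / (-Real.log ρ)⌉₊ + 1, by simp,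
    exists_pow_le_stepsize_sq hρ t _ ?_⟩
  push_cast
  linarith [Nat.le_ceil (2 * α * Real.log (t + 1) / (-Real.log ρ))]

lemma one_le_mixTime (hρ : ρ ∈ Set.Ioo (0 : ℝ) 1) (t : ℕ) : (1 : ℝ) ≤ mixTime ρ α t := by
  exact_mod_cast (mixTime_spec hρ t).1

lemma mixTime_mono (hρ : ρ ∈ Set.Ioo (0 : ℝ) 1) (hα : 0 ≤ α) : Monotone (mixTime ρ α) := by
  intro s t hst
  refine Nat.sInf_le ⟨(mixTime_spec hρ t).1, (mixTime_spec hρ t).2.trans ?_⟩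
  exact pow_le_pow_left₀ (stepsize_pos α t).le (stepsize_antitone hα hst) 2

lemma mixTime_le (hρ : ρ ∈ Set.Ioo (0 : ℝ) 1) (hα : 0 ≤ α) (t : ℕ) :
    (mixTime ρ α t : ℝ) ≤ 2 * α * Real.log (t + 1) / (-Real.log ρ) + 2 := by
  have hl : 0 < -Real.log ρ := by linarith [Real.log_neg hρ.1 hρ.2]
  have h0 : 0 ≤ 2 * α * Real.log (t + 1) / (-Real.log ρ) := by
    have : 0 ≤ Real.log (t + 1) := Real.log_nonneg (by linarith [(Nat.cast_nonneg t : (0 : ℝ) ≤ t)])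
    positivity
  have h1 : mixTime ρ α t ≤ ⌈2 * α * Real.log (t + 1) / (-Real.log ρ)⌉₊ + 1 := by
    refine Nat.sInf_le ⟨by simp, exists_pow_le_stepsize_sq hρ t _ ?_⟩
    push_cast
    linarith [Nat.le_ceil (2 * α * Real.log (t + 1) / (-Real.log ρ))]
  have h2 := Nat.ceil_lt_add_one h0
  have h3 : (mixTime ρ α t : ℝ) ≤ ⌈2 * α * Real.log (t + 1) / (-Real.log ρ)⌉₊ + 1 := by
    exact_mod_cast h1
  linarith

lemma exists_mixTime_le_log (hρ : ρ ∈ Set.Ioo (0 : ℝ) 1) (hα : 0 ≤ α) :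
    ∃ C : ℝ, 0 < C ∧ ∀ T : ℕ, 2 ≤ T → (mixTime ρ α T : ℝ) ≤ C * Real.log T := by
  have hl : 0 < -Real.log ρ := by linarith [Real.log_neg hρ.1 hρ.2]
  have h2 : 0 < Real.log 2 := Real.log_pos one_lt_two
  refine ⟨4 * α / (-Real.log ρ) + 2 / Real.log 2, by positivity, fun T hT => ?_⟩
  have hT' : (2 : ℝ) ≤ T := by exact_mod_cast hT
  have h3 : Real.log 2 ≤ Real.log T := Real.log_le_log two_pos hT'
  have h4 : Real.log (T + 1) ≤ 2 * Real.log T := by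
    rw [← Nat.cast_two, ← Real.log_pow]
    exact Real.log_le_log (by positivity) (by nlinarith)
  calc (mixTime ρ α T : ℝ) ≤ 2 * α * Real.log (T + 1) / (-Real.log ρ) + 2 := mixTime_le hρ hα T
    _ ≤ 2 * α * (2 * Real.log T) / (-Real.log ρ) + 2 / Real.log 2 * Real.log T := by
        gcongr
        rw [div_mul_eq_mul_div, le_div_iff₀ h2]; linarith
    _ = _ := by ring

/-- The logarithm is dominated by the power $(t+1)^\alpha$. This makes the bound of (A4) uniform in
time. -/
lemma exists_mixTime_mul_stepsize_le (hρ : ρ ∈ Set.Ioo (0 : ℝ) 1) (hα : 0 < α) :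
    ∃ D : ℝ, 0 < D ∧ ∀ t : ℕ, (mixTime ρ α t : ℝ) * stepsize α t ≤ D := by
  have hl : 0 < -Real.log ρ := by linarith [Real.log_neg hρ.1 hρ.2]
  refine ⟨2 / (-Real.log ρ) + 2, by positivity, fun t => ?_⟩
  have ht : (1 : ℝ) ≤ (t : ℝ) + 1 := by linarith [(Nat.cast_nonneg t : (0 : ℝ) ≤ t)]
  have h1 : (1 : ℝ) ≤ ((t : ℝ) + 1) ^ α := Real.one_le_rpow ht hα.le
  have h2 : α * Real.log (t + 1) ≤ ((t : ℝ) + 1) ^ α := by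
    have := Real.log_le_rpow_div (x := (t : ℝ) + 1) (by positivity) hα
    rw [le_div_iff₀ hα] at this; linarith
  rw [stepsize, mul_one_div, div_le_iff₀ (by positivity)]
  calc (mixTime ρ α t : ℝ) ≤ 2 * (α * Real.log (t + 1)) / (-Real.log ρ) + 2 * 1 := by
        have := mixTime_le hρ hα.le t; convert this using 2 <;> ring
    _ ≤ 2 * (((t : ℝ) + 1) ^ α) / (-Real.log ρ) + 2 * (((t : ℝ) + 1) ^ α) := by gcongr
    _ = _ := by ring

/-- An infimum over an empty set of naturals would be 0, so the content is nonemptiness: $\tau_t$ is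
logarithmic, hence eventually below $t/2$. It forces $T\ge2$ whenever $T>t_*$, where $\log T$ is
bounded away from 0. -/
lemma one_le_burnIn (hρ : ρ ∈ Set.Ioo (0 : ℝ) 1) (hα : 0 ≤ α) : 1 ≤ burnIn ρ α := by
  obtain ⟨C, hC, h⟩ := exists_mixTime_le_log hρ hα
  refine (Nat.sInf_mem (s := {t : ℕ | 0 < t ∧ 2 * mixTime ρ α t ≤ t}) ?_).1
  have hlim := (Real.isLittleO_log_id_atTop.comp_tendsto tendsto_natCast_atTop_atTop).bound
    (c := 1 / (2 * C)) (by positivity)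
  obtain ⟨t, ht, ht2⟩ := (hlim.and (Filter.eventually_ge_atTop 2)).exists
  refine ⟨t, show 0 < t by omega, ?_⟩
  have h1 := h t ht2
  have h3 : Real.log t ≤ 1 / (2 * C) * t := by
    simpa using (le_abs_self _).trans ht
  have : (2 : ℝ) * mixTime ρ α t ≤ t := by
    calc (2 : ℝ) * mixTime ρ α t ≤ 2 * (C * (1 / (2 * C) * t)) := by gcongr; exact h1.trans (by gcongr)
      _ = t := by field_simp
  exact_mod_cast this

/-- A supersolution of the backward recursion `u_s = 1 + (1 - c α_s) u_{s+1}` of order `1/α_s`. -/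
lemma exists_backward_weight (hα : α ∈ Set.Ioo (1 / 2 : ℝ) 1) {c : ℝ} (hc : 0 < c) :
    ∃ (U : ℕ → ℝ) (K : ℝ), 0 < K ∧ (∀ s, 0 ≤ U s) ∧ U 0 ≤ K ∧
      (∀ s, stepsize α s * U (s + 1) ≤ K) ∧
      ∀ s, 1 + (1 - c * stepsize α s) * U (s + 1) ≤ U s := by
  obtain ⟨h1, h2⟩ := hα
  have hlim : Filter.Tendsto (fun x : ℝ => α * x ^ (-(1 - α))) Filter.atTop (nhds 0) := by
    simpa using (tendsto_rpow_neg_atTop (y := 1 - α) (by linarith)).const_mul α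
  obtain ⟨k, hk⟩ := Filter.eventually_atTop.1
    (hlim.eventually (ge_mem_nhds (show (0 : ℝ) < c / 2 by positivity)))
  -- The shift is so large that the derivative of $x^\alpha$ is at most $c/2$ beyond it. Then
  -- $U_s=\frac2c(s+k')^\alpha$ grows by at most 1 per step, while $c\,\alpha_sU_{s+1}\ge2$; this is
  -- the supersolution inequality.
  set k' := max k 1
  have hk1 : 1 ≤ k' := le_max_right _ _
  refine ⟨fun s => 2 / c * ((s : ℝ) + k') ^ α, 2 / c * (1 + k'), by positivity, ?_, ?_, ?_, ?_⟩
  · intro s; positivity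
  · simp only [Nat.cast_zero, zero_add]
    gcongr
    calc k' ^ α ≤ k' ^ (1 : ℝ) := Real.rpow_le_rpow_of_exponent_le hk1 h2.le
      _ ≤ 1 + k' := by simp
  · intro s
    have hs : (0 : ℝ) < (s : ℝ) + 1 := by positivity
    have : stepsize α s * (2 / c * (((s + 1 : ℕ) : ℝ) + k') ^ α)
        = 2 / c * (((s : ℝ) + 1 + k') / (s + 1)) ^ α := by
      rw [stepsize, Real.div_rpow (by positivity) hs.le]; push_cast; ring
    rw [this]
    gcongr
    have h3 : ((s : ℝ) + 1 + k') / (s + 1) ≤ 1 + k' := by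
      rw [div_le_iff₀ hs]; nlinarith [(Nat.cast_nonneg s : (0 : ℝ) ≤ s)]
    calc _ ≤ (1 + k') ^ α := by gcongr
      _ ≤ (1 + k') ^ (1 : ℝ) := Real.rpow_le_rpow_of_exponent_le (by linarith) h2.le
      _ = _ := by simp
  · intro s
    have hs : (0 : ℝ) < (s : ℝ) + 1 := by positivity
    have hx : (0 : ℝ) < (s : ℝ) + k' := by positivity
    have h4 : ((s : ℝ) + k' + 1) ^ α ≤ ((s : ℝ) + k') ^ α + c / 2 := by
      have hb := rpow_one_add_le_one_add_mul_self (s := 1 / ((s : ℝ) + k'))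
        (by have : 0 ≤ 1 / ((s : ℝ) + k') := by positivity
            linarith) (p := α) (by linarith) h2.le
      have e1 : 1 + 1 / ((s : ℝ) + k') = (s + k' + 1) / (s + k') := by field_simp
      rw [e1, Real.div_rpow (by positivity) hx.le, div_le_iff₀ (by positivity)] at hb
      have h5 := hk ((s : ℝ) + k') (by
        have := le_max_left k 1
        have := (Nat.cast_nonneg s : (0 : ℝ) ≤ s)
        change k ≤ s + max k 1
        linarith)
      rw [show -(1 - α) = α - 1 by ring, Real.rpow_sub hx, Real.rpow_one] at h5
      calc _ ≤ _ := hb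
        _ = ((s : ℝ) + k') ^ α + α * (((s : ℝ) + k') ^ α / (s + k')) := by ring
        _ ≤ _ := by linarith
    have h6 : 1 ≤ stepsize α s * ((s : ℝ) + k' + 1) ^ α := by
      rw [stepsize, one_div_mul_eq_div, le_div_iff₀ (by positivity), one_mul]
      gcongr; linarith
    have h7 : ((s + 1 : ℕ) : ℝ) + k' = s + k' + 1 := by push_cast; ring
    simp only [h7]
    have e : 1 + (1 - c * stepsize α s) * (2 / c * ((s : ℝ) + k' + 1) ^ α)
      = 1 + 2 / c * ((s : ℝ) + k' + 1) ^ α - 2 * (stepsize α s * ((s : ℝ) + k' + 1) ^ α) := by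
      field_simp; ring
    rw [e]
    have : 2 / c * ((s : ℝ) + k' + 1) ^ α ≤ 2 / c * (((s : ℝ) + k') ^ α + c / 2) := by gcongr
    have e2 : 2 / c * (((s : ℝ) + k') ^ α + c / 2) = 2 / c * ((s : ℝ) + k') ^ α + 1 := by field_simp
    linarith

end StepSizes

/-! ### Coordinates adapted to a seminorm. -/

/-- Coordinates adapted to a seminorm on a space of dimension at most `n`: every vector is, up to
the kernel of the seminorm, a combination of `n` vectors of seminorm at most one, with coefficients
bounded by `2 ^ n` times its seminorm. -/
lemma exists_seminorm_coordinates (n : ℕ) : ∀ {V : Type} [AddCommGroup V] [Module ℝ V]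
    [FiniteDimensional ℝ V] (p : Seminorm ℝ V), Module.finrank ℝ V ≤ n →
    ∃ (f : Fin n → V →ₗ[ℝ] ℝ) (x : Fin n → V), (∀ k, p (x k) ≤ 1) ∧
      (∀ k v, |f k v| ≤ 2 ^ n * p v) ∧ ∀ v, p (v - ∑ k, f k v • x k) = 0 := by
  induction n with
  | zero =>
    intro V _ _ _ p hn
    have : Subsingleton V := Module.finrank_zero_iff.1 (Nat.le_zero.1 hn)
    exact ⟨fun _ => 0, fun _ => 0, fun k => k.elim0, fun k => k.elim0,
      fun v => by rw [Subsingleton.elim v 0]; simp⟩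
  | succ n ih =>
    intro V _ _ _ p hn
    by_cases hp : ∀ v, p v = 0
    · exact ⟨fun _ => 0, fun _ => 0, by simp, by simp [hp], by simp [hp]⟩
    push Not at hp
    obtain ⟨v₀, hv₀⟩ := hp
    have hpos : 0 < p v₀ := lt_of_le_of_ne (apply_nonneg p v₀) (Ne.symm hv₀)
    set x₀ := (p v₀)⁻¹ • v₀ with hx₀
    have hpx : p x₀ = 1 := by
      rw [hx₀, map_smul_eq_mul, norm_inv, Real.norm_of_nonneg hpos.le, inv_mul_cancel₀ hv₀]
    have hne : x₀ ≠ 0 := by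
      intro h; rw [h, map_zero] at hpx; exact zero_ne_one hpx
    -- Hahn–Banach: a functional dominated by $p$ and equal to 1 at the unit vector $x_0$.
    obtain ⟨f₀, hf₀, hle⟩ := exists_extension_of_le_sublinear
      (LinearPMap.mkSpanSingleton (K := ℝ) x₀ (1 : ℝ) hne) p
      (fun c hc x => by rw [map_smul_eq_mul, Real.norm_of_nonneg hc.le])
      (fun x y => map_add_le_add p x y)
      (by
        rintro ⟨x, hx⟩
        obtain ⟨c, rfl⟩ := Submodule.mem_span_singleton.1 hx
        refine (LinearPMap.mkSpanSingleton'_apply x₀ (1 : ℝ) _ c hx).le.trans ?_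
        simp only [RingHom.id_apply, smul_eq_mul, mul_one, map_smul_eq_mul, hpx]
        exact Real.le_norm_self c)
    have hf1 : f₀ x₀ = 1 := by
      have := hf₀ ⟨x₀, Submodule.mem_span_singleton_self x₀⟩
      have e := LinearPMap.mkSpanSingleton_apply (σ := RingHom.id ℝ) ℝ ℝ hne (1 : ℝ)
      exact this.trans e
    have habs : ∀ v, |f₀ v| ≤ p v := fun v => abs_le.2
      ⟨by have := hle (-v); rw [map_neg, map_neg_eq_map] at this; linarith, hle v⟩
    let W := LinearMap.ker f₀
    have hW : Module.finrank ℝ W ≤ n := by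
      have : W < ⊤ := by
        refine lt_of_le_of_ne le_top fun h => ?_
        have : x₀ ∈ W := h ▸ Submodule.mem_top
        rw [LinearMap.mem_ker, hf1] at this
        exact one_ne_zero this
      have := Submodule.finrank_lt this.ne
      omega
    obtain ⟨g, z, hz, hg, hres⟩ := ih (p.comp W.subtype) hW
    -- Projection onto the kernel of $f_0$ along $x_0$. It at most doubles the seminorm, so each
    -- dimension contributes a factor 2.
    let P : V →ₗ[ℝ] W := LinearMap.codRestrict W (LinearMap.id - f₀.smulRight x₀) (by
      intro v
      simp [W, LinearMap.mem_ker, hf1])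
    have hP : ∀ v, (P v : V) = v - f₀ v • x₀ := fun v => rfl
    refine ⟨Fin.cons f₀ (fun k => g k ∘ₗ P), Fin.cons x₀ (fun k => (z k : V)), ?_, ?_, ?_⟩
    · refine Fin.cases ?_ fun k => ?_
      · simp [hpx]
      · simpa using hz k
    · refine Fin.cases ?_ fun k => ?_
      · intro v
        simp only [Fin.cons_zero]
        have h1 : (1 : ℝ) ≤ 2 ^ (n + 1) := one_le_pow₀ one_le_two
        nlinarith [habs v, apply_nonneg p v]
      · intro v
        simp only [Fin.cons_succ, LinearMap.comp_apply]
        refine (hg k (P v)).trans ?_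
        rw [pow_succ, mul_assoc]
        gcongr
        change p (P v : V) ≤ _
        rw [hP]
        refine (map_sub_le_add p _ _).trans ?_
        rw [map_smul_eq_mul, hpx, Real.norm_eq_abs]
        linarith [habs v]
    · intro v
      have := hres (P v)
      rw [Fin.sum_univ_succ]
      simp only [Fin.cons_zero, Fin.cons_succ, LinearMap.comp_apply]
      rw [← sub_sub, ← hP]
      simpa [Seminorm.comp_apply] using this

lemma seminorm_le_sum_coordinates {V ι : Type*} [AddCommGroup V] [Module ℝ V] [Fintype ι]
    {p : Seminorm ℝ V} {f : ι → V →ₗ[ℝ] ℝ} {x : ι → V} (hx : ∀ k, p (x k) ≤ 1)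
    (hres : ∀ v, p (v - ∑ k, f k v • x k) = 0) (v : V) : p v ≤ ∑ k, |f k v| := by
  calc p v = p ((v - ∑ k, f k v • x k) + ∑ k, f k v • x k) := by rw [sub_add_cancel]
    _ ≤ 0 + ∑ k, p (f k v • x k) := by
        refine (map_add_le_add p _ _).trans (add_le_add (hres v).le ?_)
        exact Finset.le_sum_of_subadditive p (map_zero p).le (map_add_le_add p) _ _
    _ ≤ ∑ k, |f k v| := by
        rw [zero_add]
        refine Finset.sum_le_sum fun k _ => ?_
        rw [map_smul_eq_mul, Real.norm_eq_abs]
        exact mul_le_of_le_one_right (abs_nonneg _) (hx k)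

lemma seminorm_continuous {d : ℕ} (p : Seminorm ℝ (Fin d → ℝ)) : Continuous p := by
  rw [← continuousOn_univ]
  exact ConvexOn.continuousOn isOpen_univ p.convexOn

lemma linearMap_sub_eq_of_seminorm_eq_zero {V : Type*} [AddCommGroup V] [Module ℝ V]
    {p : Seminorm ℝ V} {g : V →ₗ[ℝ] ℝ} {C : ℝ} (hg : ∀ v, |g v| ≤ C * p v) {v w : V}
    (h : p (v - w) = 0) : g v = g w := by
  have := hg (v - w)
  rw [h, mul_zero, map_sub] at this
  exact sub_eq_zero.1 (abs_nonpos_iff.1 this)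

/-! ### Decorrelation from total variation bounds. -/

section Mixing

variable {Ω Y : Type*} [MeasurableSpace Y] {m mΩ : MeasurableSpace Ω}

/-- Layer cake: both integrals are $\int_0^M$ of the measures of superlevel sets $\{f\ge t\}$, and
these differ by at most $\varepsilon$ for each $t$. -/
lemma abs_integral_sub_integral_le {μ₁ μ₂ : Measure Y} [IsFiniteMeasure μ₁] [IsFiniteMeasure μ₂]
    {ε M : ℝ} (hM : 0 ≤ M)
    (hε : ∀ B : Set Y, MeasurableSet B → |μ₁.real B - μ₂.real B| ≤ ε)
    {f : Y → ℝ} (hf : Measurable f) (h0 : ∀ y, 0 ≤ f y) (h1 : ∀ y, f y ≤ M) :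
    |∫ y, f y ∂μ₁ - ∫ y, f y ∂μ₂| ≤ M * ε := by
  have hint : ∀ (ν : Measure Y) [IsFiniteMeasure ν], Integrable f ν := fun ν _ =>
    Integrable.of_bound hf.aestronglyMeasurable M
      (Filter.Eventually.of_forall fun y => by rw [Real.norm_of_nonneg (h0 y)]; exact h1 y)
  have hI : ∀ (ν : Measure Y) [IsFiniteMeasure ν],
      IntegrableOn (fun t => ν.real {a | t ≤ f a}) (Set.Ioc 0 M) := fun ν _ => by
    refine AntitoneOn.integrableOn_of_measure_ne_top (s := Set.Icc 0 M) ?_ (a := 0) (b := M)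
      ?_ ?_ ?_ ?_ |>.mono_set Set.Ioc_subset_Icc_self
    · exact fun a _ b _ hab => measureReal_mono fun x hx => hab.trans hx
    · exact ⟨⟨le_rfl, hM⟩, fun x hx => hx.1⟩
    · exact ⟨⟨hM, le_rfl⟩, fun x hx => hx.2⟩
    · simp
    · exact measurableSet_Icc
  rw [(hint μ₁).integral_eq_integral_Ioc_meas_le (Filter.Eventually.of_forall h0)
    (Filter.Eventually.of_forall h1), (hint μ₂).integral_eq_integral_Ioc_meas_le
    (Filter.Eventually.of_forall h0) (Filter.Eventually.of_forall h1),
    ← integral_sub (hI μ₁) (hI μ₂)]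
  have := norm_setIntegral_le_of_norm_le_const (μ := volume) (s := Set.Ioc 0 M) (C := ε)
    (f := fun t => μ₁.real {a | t ≤ f a} - μ₂.real {a | t ≤ f a}) (by simp)
    (fun t _ => hε _ (measurableSet_le measurable_const hf))
  rw [Real.norm_eq_abs] at this
  refine this.trans ?_
  rw [Real.volume_real_Ioc_of_le hM, sub_zero, mul_comm]

/-- The law of $y$ under the weighted measure $W\,d\mu$ is compared with $(\int W)\,\eta$.
Conditioning on $m$ event by event shows that they differ by at most $\varepsilon\int W$ on every
set, and the layer cake bound applies without a regular conditional law. -/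
lemma abs_integral_mul_comp_le_of_nonneg {μ : Measure Ω} [IsProbabilityMeasure μ]
    (hm : m ≤ mΩ) {η : Measure Y} [IsProbabilityMeasure η] {y : Ω → Y}
    (hy : Measurable y) {ε M : ℝ} (hM : 0 ≤ M)
    (hmix : ∀ B : Set Y, MeasurableSet B →
      ∀ᵐ ω ∂μ, |(μ[(y ⁻¹' B).indicator (fun _ => (1 : ℝ)) | m]) ω - η.real B| ≤ ε)
    {ψ : Y → ℝ} (hψ : Measurable ψ) (hψM : ∀ y, |ψ y| ≤ M) (hψ0 : ∫ y, ψ y ∂η = 0)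
    {W : Ω → ℝ} (hW : Measurable[m] W) (hWi : Integrable W μ) (hW0 : ∀ ω, 0 ≤ W ω) :
    |∫ ω, W ω * ψ (y ω) ∂μ| ≤ 2 * M * (ε * ∫ ω, W ω ∂μ) := by
  have hWm : Measurable W := hW.mono hm le_rfl
  set ν := μ.withDensity (fun ω => ENNReal.ofReal (W ω)) with hν
  have hνf : IsFiniteMeasure ν :=
    isFiniteMeasure_withDensity_ofReal hWi.hasFiniteIntegral
  have hμ1 : IsFiniteMeasure (ν.map y) := inferInstance
  set c := ∫ ω, W ω ∂μ
  have hc : 0 ≤ c := integral_nonneg hW0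
  let μ₂ := (ENNReal.ofReal c) • η
  have hμ2 : IsFiniteMeasure μ₂ := Measure.smul_finite η ENNReal.ofReal_ne_top
  have hint1 : ∀ f : Y → ℝ, Measurable f → ∫ z, f z ∂(ν.map y) = ∫ ω, W ω * f (y ω) ∂μ := by
    intro f hf
    rw [integral_map hy.aemeasurable hf.aestronglyMeasurable, hν,
      integral_withDensity_eq_integral_toReal_smul hWm.ennreal_ofReal
        (Filter.Eventually.of_forall fun _ => ENNReal.ofReal_lt_top)]
    refine integral_congr_ae (Filter.Eventually.of_forall fun ω => ?_)
    simp [ENNReal.toReal_ofReal (hW0 ω)]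
  have hint2 : ∀ f : Y → ℝ, ∫ z, f z ∂μ₂ = c * ∫ z, f z ∂η := by
    intro f
    rw [integral_smul_measure, ENNReal.toReal_ofReal hc, smul_eq_mul]
  have hreal : ∀ B, MeasurableSet B → |(ν.map y).real B - μ₂.real B| ≤ ε * c := by
    intro B hB
    have hind : Measurable (B.indicator (fun _ : Y => (1 : ℝ))) := measurable_const.indicator hB
    have e1 : (ν.map y).real B = ∫ ω, W ω * (y ⁻¹' B).indicator (fun _ => (1 : ℝ)) ω ∂μ := by
      have := hint1 _ hind
      rw [integral_indicator hB, setIntegral_const, smul_eq_mul, mul_one] at this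
      exact this
    have e2 : μ₂.real B = c * η.real B := by
      have := hint2 (B.indicator (fun _ : Y => (1 : ℝ)))
      rwa [integral_indicator hB, setIntegral_const, integral_indicator hB, setIntegral_const,
        smul_eq_mul, smul_eq_mul, mul_one, mul_one] at this
    set I : Ω → ℝ := (y ⁻¹' B).indicator (fun _ => (1 : ℝ)) with hI
    have hIi : Integrable I μ := (integrable_const 1).indicator (hy hB)
    have hIb : ∀ ω, ‖I ω‖ ≤ 1 := fun ω => by
      by_cases h : ω ∈ y ⁻¹' B <;> simp [hI, h]
    have hWI : Integrable (W * I) μ := by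
      refine Integrable.mul_bdd (c := 1) hWi hIi.aestronglyMeasurable
        (Filter.Eventually.of_forall hIb)
    have e3 : ∫ ω, W ω * I ω ∂μ = ∫ ω, W ω * (μ[I | m]) ω ∂μ := by
      rw [← integral_condExp hm (f := fun ω => W ω * I ω)]
      exact integral_congr_ae (condExp_mul_of_stronglyMeasurable_left
        hW.stronglyMeasurable hWI hIi)
    have hWc : Integrable (fun ω => W ω * (μ[I | m]) ω) μ :=
      (integrable_condExp (f := W * I) (m := m) (μ := μ)).congr
        (condExp_mul_of_stronglyMeasurable_left hW.stronglyMeasurable hWI hIi)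
    rw [e1, e2, e3, mul_comm c, ← integral_const_mul, ← integral_sub hWc (hWi.const_mul _),
      ← integral_const_mul]
    rw [← Real.norm_eq_abs]
    refine norm_integral_le_of_norm_le (hWi.const_mul _) ?_
    filter_upwards [hmix B hB] with ω hω
    rw [Real.norm_eq_abs, show W ω * (μ[I | m]) ω - η.real B * W ω
      = ((μ[I | m]) ω - η.real B) * W ω by ring, abs_mul, abs_of_nonneg (hW0 ω)]
    exact mul_le_mul_of_nonneg_right hω (hW0 ω)
  -- Shifting $\psi$ by $M$ puts its values in $[0,2M]$; the shift cancels because both measures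
  -- have mass $\int W$.
  have key := abs_integral_sub_integral_le (M := 2 * M) (by positivity) hreal
    (hψ.add_const M) (fun z => by linarith [neg_le_of_abs_le (hψM z)])
    (fun z => by linarith [le_of_abs_le (hψM z)])
  rw [hint1 _ (hψ.add_const M), hint2] at key
  have hψη : Integrable ψ η := Integrable.of_bound hψ.aestronglyMeasurable M
    (Filter.Eventually.of_forall hψM)
  have hWψ : Integrable (fun ω => W ω * ψ (y ω)) μ :=
    Integrable.mul_bdd (c := M) hWi (hψ.comp hy).aestronglyMeasurable
      (Filter.Eventually.of_forall fun ω => hψM _)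
  rw [integral_add hψη (integrable_const M), hψ0] at key
  simp only [mul_add] at key
  rw [integral_add hWψ (hWi.mul_const M), integral_mul_const] at key
  simpa [c] using key

/-- Decorrelation: a centred bounded observable of a variable that mixes given `m` is nearly
orthogonal to every `m`-measurable variable. -/
lemma abs_integral_mul_comp_le {μ : Measure Ω} [IsProbabilityMeasure μ]
    (hm : m ≤ mΩ) {η : Measure Y} [IsProbabilityMeasure η] {y : Ω → Y}
    (hy : Measurable y) {ε M : ℝ} (hM : 0 ≤ M)
    (hmix : ∀ B : Set Y, MeasurableSet B →
      ∀ᵐ ω ∂μ, |(μ[(y ⁻¹' B).indicator (fun _ => (1 : ℝ)) | m]) ω - η.real B| ≤ ε)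
    {ψ : Y → ℝ} (hψ : Measurable ψ) (hψM : ∀ y, |ψ y| ≤ M) (hψ0 : ∫ y, ψ y ∂η = 0)
    {W : Ω → ℝ} (hW : Measurable[m] W) (hWi : Integrable W μ) :
    |∫ ω, W ω * ψ (y ω) ∂μ| ≤ 2 * M * (ε * ∫ ω, |W ω| ∂μ) := by
  have hp := abs_integral_mul_comp_le_of_nonneg hm hy hM hmix hψ hψM hψ0
    (hW.max measurable_const) hWi.pos_part (fun ω => le_max_right (W ω) 0)
  have hn := abs_integral_mul_comp_le_of_nonneg hm hy hM hmix hψ hψM hψ0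
    (hW.neg.max measurable_const) hWi.neg_part (fun ω => le_max_right (-W ω) 0)
  simp only [Pi.neg_apply] at hn
  have hb : ∀ V : Ω → ℝ, Integrable V μ → Integrable (fun ω => V ω * ψ (y ω)) μ := fun V hV =>
    Integrable.mul_bdd (c := M) hV (hψ.comp hy).aestronglyMeasurable
      (Filter.Eventually.of_forall fun ω => hψM _)
  have e1 : ∫ ω, W ω * ψ (y ω) ∂μ
      = ∫ ω, max (W ω) 0 * ψ (y ω) ∂μ - ∫ ω, max (-W ω) 0 * ψ (y ω) ∂μ := by
    rw [← integral_sub (hb _ hWi.pos_part) (hb _ hWi.neg_part)]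
    refine integral_congr_ae (Filter.Eventually.of_forall fun ω => ?_)
    rcases le_total (W ω) 0 with h | h
    · simp [max_eq_right h, max_eq_left (neg_nonneg.2 h)]
    · simp [max_eq_left h, max_eq_right (neg_nonpos.2 h)]
  have e2 : ∫ ω, |W ω| ∂μ = ∫ ω, max (W ω) 0 ∂μ + ∫ ω, max (-W ω) 0 ∂μ := by
    rw [← integral_add hWi.pos_part hWi.neg_part]
    refine integral_congr_ae (Filter.Eventually.of_forall fun ω => ?_)
    rcases le_total (W ω) 0 with h | h
    · simp [max_eq_right h, max_eq_left (neg_nonneg.2 h), abs_of_nonpos h]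
    · simp [max_eq_left h, max_eq_right (neg_nonpos.2 h), abs_of_nonneg h]
  rw [e1, e2]
  refine (abs_sub _ _).trans ?_
  linarith

end Mixing

/-! ### Second moments of sums of weakly dependent variables. -/

section SecondMoments

variable {Ω Y : Type*} [MeasurableSpace Y] {mΩ : MeasurableSpace Ω} {μ : Measure Ω}

lemma integrable_mul_of_sq {f g : Ω → ℝ} (hf : AEStronglyMeasurable f μ)
    (hg : AEStronglyMeasurable g μ) (hf2 : Integrable (fun ω => f ω ^ 2) μ)
    (hg2 : Integrable (fun ω => g ω ^ 2) μ) : Integrable (fun ω => f ω * g ω) μ :=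
  ((memLp_two_iff_integrable_sq hf).2 hf2).integrable_mul ((memLp_two_iff_integrable_sq hg).2 hg2)

lemma integral_abs_mul_le {f g : Ω → ℝ} (hf : AEStronglyMeasurable f μ)
    (hg : AEStronglyMeasurable g μ) (hf2 : Integrable (fun ω => f ω ^ 2) μ)
    (hg2 : Integrable (fun ω => g ω ^ 2) μ) :
    ∫ ω, |f ω * g ω| ∂μ ≤ (∫ ω, f ω ^ 2 ∂μ + ∫ ω, g ω ^ 2 ∂μ) / 2 := by
  rw [← integral_add hf2 hg2, ← integral_div]
  refine integral_mono (integrable_mul_of_sq hf hg hf2 hg2).abs ((hf2.add hg2).div_const 2)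
    fun ω => ?_
  change |f ω * g ω| ≤ (f ω ^ 2 + g ω ^ 2) / 2
  rw [abs_mul]
  nlinarith [sq_nonneg (|f ω| - |g ω|), sq_abs (f ω), sq_abs (g ω)]

lemma integrable_sq_mul_comp {y : ℕ → Ω → Y} {ψ : ℕ → Y → ℝ} {M : ℝ} {W : ℕ → Ω → ℝ}
    (hy : ∀ t, Measurable (y t)) (hψ : ∀ s, Measurable (ψ s))
    (hψM : ∀ s z, |ψ s z| ≤ M) (s : ℕ)
    (hWi : Integrable (fun ω => W s ω ^ 2) μ) :
    Integrable (fun ω => (ψ s (y s ω) * W s ω) ^ 2) μ := by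
  simp only [mul_pow]
  refine Integrable.bdd_mul (c := M ^ 2) hWi
    (((hψ s).comp (hy s)).pow_const 2).aestronglyMeasurable
    (Filter.Eventually.of_forall fun ω => ?_)
  rw [Real.norm_eq_abs, abs_pow]
  exact pow_le_pow_left₀ (abs_nonneg _) (hψM s _) 2

variable [IsProbabilityMeasure μ]

lemma integral_abs_le_sqrt {f : Ω → ℝ} (hf : AEStronglyMeasurable f μ)
    (hf2 : Integrable (fun ω => f ω ^ 2) μ) : ∫ ω, |f ω| ∂μ ≤ √(∫ ω, f ω ^ 2 ∂μ) := by
  have h := ((memLp_two_iff_integrable_sq hf).2 hf2).abs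
  have hv := variance_eq_sub h
  have h0 := variance_nonneg (fun ω => |f ω|) μ
  change Var[fun ω => |f ω|; μ] = _ at hv
  refine Real.le_sqrt_of_sq_le ?_
  have e : μ[(fun ω => |f ω|) ^ 2] = ∫ ω, f ω ^ 2 ∂μ := by
    simp [sq_abs]
  change _ = μ[(fun ω => |f ω|) ^ 2] - _ at hv
  rw [e] at hv
  change _ = _ - (∫ ω, |f ω| ∂μ) ^ 2 at hv
  linarith

/-- Variances of pairwise independent variables add, so only the squared mean escapes the factor
$1/N$. -/
lemma integral_sq_average_le {N : ℕ} (hN : 0 < N) {Z : Fin N → Ω → ℝ}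
    (hZ : ∀ i, MemLp (Z i) 2 μ)
    (hind : Pairwise fun i j => IndepFun (Z i) (Z j) μ) {v m : ℝ}
    (hv : ∀ i, ∫ ω, Z i ω ^ 2 ∂μ ≤ v) (hm : ∀ i, |∫ ω, Z i ω ∂μ| ≤ m) :
    ∫ ω, ((1 / (N : ℝ)) * ∑ i, Z i ω) ^ 2 ∂μ ≤ v / N + m ^ 2 := by
  have hN' : (0 : ℝ) < N := by exact_mod_cast hN
  have hS : MemLp (∑ i, Z i) 2 μ := memLp_finsetSum' _ fun i _ => hZ i
  have h1 := variance_eq_sub hS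
  have h2 := IndepFun.variance_sum (s := Finset.univ) (fun i _ => hZ i)
    (fun i _ j _ hij => hind hij)
  have h3 : ∀ i, Var[Z i; μ] ≤ v := fun i => by
    refine (variance_le_expectation_sq (hZ i).aestronglyMeasurable).trans ?_
    simpa using hv i
  have h4 : ∑ i, Var[Z i; μ] ≤ N * v := by
    refine (Finset.sum_le_sum fun i _ => h3 i).trans ?_
    simp
  have h5 : |μ[∑ i, Z i]| ≤ N * m := by
    have : μ[∑ i, Z i] = ∑ i, ∫ ω, Z i ω ∂μ := by
      simp only [Finset.sum_apply]
      exact integral_finsetSum _ fun i _ => (hZ i).integrable one_le_two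
    rw [this]
    refine (Finset.abs_sum_le_sum_abs _ _).trans ((Finset.sum_le_sum fun i _ => hm i).trans ?_)
    simp
  have h6 : μ[∑ i, Z i] ^ 2 ≤ (N * m) ^ 2 := sq_le_sq' (abs_le.1 h5).1 (abs_le.1 h5).2
  have e : ∫ ω, ((1 / (N : ℝ)) * ∑ i, Z i ω) ^ 2 ∂μ = (1 / (N : ℝ)) ^ 2 * μ[(∑ i, Z i) ^ 2] := by
    rw [← integral_const_mul]
    simp [mul_pow]
  have h7 : μ[(∑ i, Z i) ^ 2] ≤ N * v + (N * m) ^ 2 := by linarith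
  rw [e]
  calc _ ≤ (1 / (N : ℝ)) ^ 2 * (N * v + (N * m) ^ 2) := by gcongr
    _ = _ := by field_simp

variable {𝓕 : ℕ → MeasurableSpace Ω} {y : ℕ → Ω → Y} {η : Measure Y} [IsProbabilityMeasure η]
  {ψ : ℕ → Y → ℝ} {ε M : ℝ} {τ : ℕ}

section Weighted

variable {W : ℕ → Ω → ℝ}

/-- Since $r+1\le s-\tau$, everything except $\psi_s(y_s)$ is measurable for the history at time
$s-\tau$, so the decorrelation bound applies to that single centred factor. -/
lemma integral_mul_mul_le_of_lag (h𝓕 : ∀ t, 𝓕 t ≤ mΩ) (hmono : Monotone 𝓕)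
    (hy𝓕 : ∀ t, Measurable[𝓕 (t + 1)] (y t)) (hM : 0 ≤ M) (hε : 0 ≤ ε)
    (hmix : ∀ t, τ < t → ∀ B : Set Y, MeasurableSet B →
      ∀ᵐ ω ∂μ, |(μ[(y t ⁻¹' B).indicator (fun _ => (1 : ℝ)) | 𝓕 (t - τ)]) ω - η.real B| ≤ ε)
    (hψ : ∀ s, Measurable (ψ s)) (hψM : ∀ s z, |ψ s z| ≤ M) (hψ0 : ∀ s, ∫ z, ψ s z ∂η = 0)
    (hW : ∀ s, Measurable[𝓕 (s - τ)] (W s)) (hWi : ∀ s, Integrable (fun ω => W s ω ^ 2) μ)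
    {r s : ℕ} (hrs : r + τ < s) :
    ∫ ω, (ψ s (y s ω) * W s ω) * (ψ r (y r ω) * W r ω) ∂μ
      ≤ M ^ 2 * (2 * ε) * ((∫ ω, W s ω ^ 2 ∂μ + ∫ ω, W r ω ^ 2 ∂μ) / 2) := by
  have hWm : ∀ s, Measurable (W s) := fun s => (hW s).mono (h𝓕 _) le_rfl
  have hym : ∀ t, Measurable (y t) := fun t => (hy𝓕 t).mono (h𝓕 _) le_rfl
  have hVm : Measurable[𝓕 (s - τ)] (fun ω => W s ω * (ψ r (y r ω) * W r ω)) := by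
    refine (hW s).mul (Measurable.mul ?_ ?_)
    · exact (hψ r).comp ((hy𝓕 r).mono (hmono (by omega)) le_rfl)
    · exact (hW r).mono (hmono (by omega)) le_rfl
  have hri := integrable_sq_mul_comp hym hψ hψM r (hWi r)
  have hrm : AEStronglyMeasurable (fun ω => ψ r (y r ω) * W r ω) μ :=
    (((hψ r).comp (hym r)).mul (hWm r)).aestronglyMeasurable
  have hVi : Integrable (fun ω => W s ω * (ψ r (y r ω) * W r ω)) μ :=
    integrable_mul_of_sq (hWm s).aestronglyMeasurable hrm (hWi s) hri
  have h1 := abs_integral_mul_comp_le (h𝓕 (s - τ)) (hym s) hM (hmix s (by omega)) (hψ s) (hψM s)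
    (hψ0 s) hVm hVi
  have h2 : ∫ ω, |W s ω * (ψ r (y r ω) * W r ω)| ∂μ
      ≤ M * ((∫ ω, W s ω ^ 2 ∂μ + ∫ ω, W r ω ^ 2 ∂μ) / 2) := by
    refine le_trans ?_ (mul_le_mul_of_nonneg_left (integral_abs_mul_le (hWm s).aestronglyMeasurable
      (hWm r).aestronglyMeasurable (hWi s) (hWi r)) hM)
    rw [← integral_const_mul]
    refine integral_mono hVi.abs ((integrable_mul_of_sq (hWm s).aestronglyMeasurable
      (hWm r).aestronglyMeasurable (hWi s) (hWi r)).abs.const_mul M) fun ω => ?_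
    change |W s ω * (ψ r (y r ω) * W r ω)| ≤ M * |W s ω * W r ω|
    rw [show W s ω * (ψ r (y r ω) * W r ω) = ψ r (y r ω) * (W s ω * W r ω) by ring, abs_mul]
    exact mul_le_mul_of_nonneg_right (hψM r _) (abs_nonneg _)
  calc _ = ∫ ω, W s ω * (ψ r (y r ω) * W r ω) * ψ s (y s ω) ∂μ := by
        congr 1; ext ω; ring
    _ ≤ _ := le_of_abs_le h1
    _ ≤ 2 * M * (ε * (M * ((∫ ω, W s ω ^ 2 ∂μ + ∫ ω, W r ω ^ 2 ∂μ) / 2))) := by gcongr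
    _ = _ := by ring

/-- Second moment of a sum of centred bounded observables of a mixing sequence with weights that are
measurable with lag `τ`. -/
lemma integral_sq_sum_le_of_mixing (h𝓕 : ∀ t, 𝓕 t ≤ mΩ) (hmono : Monotone 𝓕)
    (hy𝓕 : ∀ t, Measurable[𝓕 (t + 1)] (y t)) (hM : 0 ≤ M) (hε : 0 ≤ ε)
    (hmix : ∀ t, τ < t → ∀ B : Set Y, MeasurableSet B →
      ∀ᵐ ω ∂μ, |(μ[(y t ⁻¹' B).indicator (fun _ => (1 : ℝ)) | 𝓕 (t - τ)]) ω - η.real B| ≤ ε)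
    (hψ : ∀ s, Measurable (ψ s)) (hψM : ∀ s z, |ψ s z| ≤ M) (hψ0 : ∀ s, ∫ z, ψ s z ∂η = 0)
    (hW : ∀ s, Measurable[𝓕 (s - τ)] (W s)) (hWi : ∀ s, Integrable (fun ω => W s ω ^ 2) μ)
    (T : ℕ) :
    ∫ ω, (∑ s ∈ Finset.range T, ψ s (y s ω) * W s ω) ^ 2 ∂μ
      ≤ M ^ 2 * (2 * τ + 1 + 2 * ε * T) * ∑ s ∈ Finset.range T, ∫ ω, W s ω ^ 2 ∂μ := by
  have hWm : ∀ s, Measurable (W s) := fun s => (hW s).mono (h𝓕 _) le_rfl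
  have hym : ∀ t, Measurable (y t) := fun t => (hy𝓕 t).mono (h𝓕 _) le_rfl
  have hsq := fun s => integrable_sq_mul_comp hym hψ hψM s (hWi s)
  have ham : ∀ s, AEStronglyMeasurable (fun ω => ψ s (y s ω) * W s ω) μ := fun s =>
    (((hψ s).comp (hym s)).mul (hWm s)).aestronglyMeasurable
  set v : ℕ → ℝ := fun s => ∫ ω, W s ω ^ 2 ∂μ with hv
  have hv0 : ∀ s, 0 ≤ v s := fun s => integral_nonneg fun ω => sq_nonneg _
  -- Correlation majorant: pairs within distance $\tau$ are bounded trivially, all others through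
  -- mixing. With $2ab\le a^2+b^2$ and symmetry, only the row sums of `c` matter; a row has at most
  -- $2\tau+1$ near pairs.
  let c : ℕ → ℕ → ℝ := fun s r => (if s ≤ r + τ ∧ r ≤ s + τ then 1 else 0) + 2 * ε
  have hpair : ∀ s r, ∫ ω, (ψ s (y s ω) * W s ω) * (ψ r (y r ω) * W r ω) ∂μ
      ≤ M ^ 2 * c s r * ((v s + v r) / 2) := by
    intro s r
    have hvv : 0 ≤ (v s + v r) / 2 := by linarith [hv0 s, hv0 r]
    by_cases h : s ≤ r + τ ∧ r ≤ s + τ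
    · calc _ ≤ ∫ ω, M ^ 2 * |W s ω * W r ω| ∂μ := by
            refine integral_mono (integrable_mul_of_sq (ham s) (ham r) (hsq s) (hsq r))
              ((integrable_mul_of_sq (hWm s).aestronglyMeasurable (hWm r).aestronglyMeasurable
                (hWi s) (hWi r)).abs.const_mul _) fun ω => ?_
            refine (le_abs_self _).trans ?_
            change |ψ s (y s ω) * W s ω * (ψ r (y r ω) * W r ω)| ≤ M ^ 2 * |W s ω * W r ω|
            rw [show ψ s (y s ω) * W s ω * (ψ r (y r ω) * W r ω)
              = (ψ s (y s ω) * ψ r (y r ω)) * (W s ω * W r ω) by ring, abs_mul, abs_mul (ψ s _), sq]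
            gcongr <;> exact hψM _ _
        _ ≤ M ^ 2 * ((v s + v r) / 2) := by
            rw [integral_const_mul]
            gcongr
            exact integral_abs_mul_le (hWm s).aestronglyMeasurable (hWm r).aestronglyMeasurable
              (hWi s) (hWi r)
        _ ≤ _ := by
            simp only [c, if_pos h]
            have : M ^ 2 * 1 ≤ M ^ 2 * (1 + 2 * ε) := by gcongr; linarith
            rw [mul_one] at this
            gcongr
    · have hc : c s r = 2 * ε := by simp [c, if_neg h]
      rw [hc]
      rcases lt_or_ge (r + τ) s with h1 | h1
      · exact integral_mul_mul_le_of_lag h𝓕 hmono hy𝓕 hM hε hmix hψ hψM hψ0 hW hWi h1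
      · have h2 : s + τ < r := by
          by_contra h3; exact h ⟨h1, by omega⟩
        have := integral_mul_mul_le_of_lag h𝓕 hmono hy𝓕 hM hε hmix hψ hψM hψ0 hW hWi h2
        rw [add_comm (v s)]
        simpa only [mul_comm (ψ r _ * W r _)] using this
  have hcsum : ∀ s, ∑ r ∈ Finset.range T, c s r ≤ 2 * τ + 1 + 2 * ε * T := by
    intro s
    simp only [c]
    rw [Finset.sum_add_distrib, Finset.sum_const, Finset.card_range, nsmul_eq_mul,
      Finset.sum_boole]
    have : (Finset.range T).filter (fun r => s ≤ r + τ ∧ r ≤ s + τ) ⊆ Finset.Icc (s - τ) (s + τ) := by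
      intro r hr
      simp only [Finset.mem_filter, Finset.mem_Icc] at hr ⊢
      omega
    have h1 := Finset.card_le_card this
    rw [Nat.card_Icc] at h1
    have h2 : ((Finset.range T).filter (fun r => s ≤ r + τ ∧ r ≤ s + τ)).card ≤ 2 * τ + 1 := by omega
    have h3 : (((Finset.range T).filter (fun r => s ≤ r + τ ∧ r ≤ s + τ)).card : ℝ) ≤ 2 * τ + 1 := by
      exact_mod_cast h2
    linarith
  have hcsymm : ∀ s r, c s r = c r s := fun s r => by
    simp only [c, and_comm]
  calc ∫ ω, (∑ s ∈ Finset.range T, ψ s (y s ω) * W s ω) ^ 2 ∂μ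
      = ∑ s ∈ Finset.range T, ∑ r ∈ Finset.range T,
          ∫ ω, (ψ s (y s ω) * W s ω) * (ψ r (y r ω) * W r ω) ∂μ := by
        simp only [sq, Finset.sum_mul_sum]
        rw [integral_finsetSum _ fun s _ => integrable_finsetSum _ fun r _ =>
          integrable_mul_of_sq (ham s) (ham r) (hsq s) (hsq r)]
        refine Finset.sum_congr rfl fun s _ => ?_
        rw [integral_finsetSum _ fun r _ => integrable_mul_of_sq (ham s) (ham r) (hsq s) (hsq r)]
    _ ≤ ∑ s ∈ Finset.range T, ∑ r ∈ Finset.range T, M ^ 2 * c s r * ((v s + v r) / 2) :=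
        Finset.sum_le_sum fun s _ => Finset.sum_le_sum fun r _ => hpair s r
    _ = M ^ 2 * ∑ s ∈ Finset.range T, (∑ r ∈ Finset.range T, c s r) * v s := by
        have e1 : ∑ s ∈ Finset.range T, ∑ r ∈ Finset.range T, c s r * v r
            = ∑ s ∈ Finset.range T, ∑ r ∈ Finset.range T, c s r * v s := by
          rw [Finset.sum_comm]
          simp only [hcsymm]
        simp only [Finset.sum_mul]
        have e2 : ∀ s r, M ^ 2 * c s r * ((v s + v r) / 2)
            = M ^ 2 / 2 * (c s r * v s) + M ^ 2 / 2 * (c s r * v r) := fun s r => by ring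
        simp only [e2, Finset.sum_add_distrib, ← Finset.mul_sum]
        rw [e1]; ring
    _ ≤ M ^ 2 * ∑ s ∈ Finset.range T, (2 * τ + 1 + 2 * ε * T) * v s := by
        gcongr with s _
        exact hcsum s
    _ = _ := by rw [← Finset.mul_sum]; ring

end Weighted

/-- Only the first $\tau+1$ terms lack a history $\tau$ steps back; each of the others has mean at
most $2M\varepsilon$. The bias is therefore of order $\tau$ rather than $\sqrt{T}$. -/
lemma abs_integral_sum_le_of_mixing (h𝓕 : ∀ t, 𝓕 t ≤ mΩ)
    (hy : ∀ t, Measurable (y t)) (hM : 0 ≤ M) (hε : 0 ≤ ε)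
    (hmix : ∀ t, τ < t → ∀ B : Set Y, MeasurableSet B →
      ∀ᵐ ω ∂μ, |(μ[(y t ⁻¹' B).indicator (fun _ => (1 : ℝ)) | 𝓕 (t - τ)]) ω - η.real B| ≤ ε)
    (hψ : ∀ s, Measurable (ψ s)) (hψM : ∀ s z, |ψ s z| ≤ M) (hψ0 : ∀ s, ∫ z, ψ s z ∂η = 0)
    (T : ℕ) :
    |∫ ω, ∑ s ∈ Finset.range T, ψ s (y s ω) ∂μ| ≤ M * (τ + 1 + 2 * ε * T) := by
  have hi : ∀ s, Integrable (fun ω => ψ s (y s ω)) μ := fun s =>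
    Integrable.of_bound ((hψ s).comp (hy s)).aestronglyMeasurable M
      (Filter.Eventually.of_forall fun ω => hψM s _)
  have hb : ∀ s, |∫ ω, ψ s (y s ω) ∂μ| ≤ (if s ∈ Finset.range (τ + 1) then M else 0) + 2 * M * ε := by
    intro s
    split_ifs with h
    · have : |∫ ω, ψ s (y s ω) ∂μ| ≤ M := by
        have := norm_integral_le_of_norm_le_const (μ := μ) (f := fun ω => ψ s (y s ω)) (C := M)
          (Filter.Eventually.of_forall fun ω => hψM s _)
        simpa using this
      have : 0 ≤ 2 * M * ε := by positivity
      linarith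
    · have h1 := abs_integral_mul_comp_le (h𝓕 (s - τ)) (hy s) hM
        (hmix s (by simpa [Nat.lt_succ_iff] using h)) (hψ s) (hψM s) (hψ0 s)
        (W := fun _ => (1 : ℝ)) measurable_const (integrable_const 1)
      simp only [one_mul, abs_one, integral_const, probReal_univ, smul_eq_mul, mul_one] at h1
      linarith
  rw [integral_finsetSum _ fun s _ => hi s]
  refine (Finset.abs_sum_le_sum_abs _ _).trans ((Finset.sum_le_sum fun s _ => hb s).trans ?_)
  rw [Finset.sum_add_distrib, Finset.sum_const, Finset.card_range, nsmul_eq_mul]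
  have : ∑ s ∈ Finset.range T, (if s ∈ Finset.range (τ + 1) then M else 0) ≤ (τ + 1) * M := by
    rw [← Finset.sum_filter, Finset.sum_const, nsmul_eq_mul]
    gcongr
    have : ((Finset.range T).filter (fun s => s ∈ Finset.range (τ + 1))).card ≤ τ + 1 := by
      refine (Finset.card_le_card (t := Finset.range (τ + 1)) ?_).trans (by simp)
      intro s hs; exact (Finset.mem_filter.1 hs).2
    exact_mod_cast this
  linarith

end SecondMoments

/-! ### Backward summation of a linear recursion. -/

section LinearRecursion

variable {V : Type*} [AddCommGroup V] [Module ℝ V]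

/-- The maps `L_T = 0`, `L_s = 1 + L_{s+1} (1 - a_s (1 - G))`, which sum the linear recursion with
steps `a` and mean operator `G`, are bounded by any supersolution of the scalar recursion. -/
lemma exists_backward_maps (p : Seminorm ℝ V) (G : V →ₗ[ℝ] V) {β : ℝ}
    (hG : ∀ x, p (G x) ≤ β * p x) (T : ℕ) :
    ∀ (a U : ℕ → ℝ), (∀ s, 0 ≤ a s) → (∀ s, a s ≤ 1) → (∀ s, 0 ≤ U s) →
      (∀ s, 1 + (1 - (1 - β) * a s) * U (s + 1) ≤ U s) →
    ∃ L : ℕ → V →ₗ[ℝ] V, L T = 0 ∧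
      (∀ s < T, ∀ x, L s x = x + L (s + 1) (x - a s • (x - G x))) ∧
      ∀ s ≤ T, ∀ x, p (L s x) ≤ U s * p x := by
  induction T with
  | zero =>
    intro a U _ _ hU _
    exact ⟨fun _ => 0, rfl, by simp, fun s _ x => by
      simpa using mul_nonneg (hU s) (apply_nonneg p x)⟩
  | succ T ih =>
    intro a U ha0 ha1 hU hrec
    obtain ⟨L, h0, h1, h2⟩ := ih (fun s => a (s + 1)) (fun s => U (s + 1)) (fun s => ha0 _)
      (fun s => ha1 _) (fun s => hU _) (fun s => hrec _)
    -- The induction hypothesis is applied to the sequences shifted by one, and a new map is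
    -- prepended at time 0; hence the quantification over `a` and `U` inside the induction.
    refine ⟨fun s => Nat.casesOn s
      (LinearMap.id + L 0 ∘ₗ (LinearMap.id - a 0 • (LinearMap.id - G))) L, h0, ?_, ?_⟩
    · rintro (_ | s) hs x
      · rfl
      · exact h1 s (by omega) x
    · rintro (_ | s) hs x
      · change p (x + L 0 (x - a 0 • (x - G x))) ≤ _
        have e : x - a 0 • (x - G x) = (1 - a 0) • x + a 0 • G x := by module
        have hb : p (x - a 0 • (x - G x)) ≤ (1 - (1 - β) * a 0) * p x := by
          rw [e]
          refine (map_add_le_add p _ _).trans ?_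
          rw [map_smul_eq_mul, map_smul_eq_mul, Real.norm_of_nonneg (ha0 0),
            Real.norm_of_nonneg (by linarith [ha1 0])]
          nlinarith [mul_le_mul_of_nonneg_left (hG x) (ha0 0)]
        calc _ ≤ p x + U 1 * p (x - a 0 • (x - G x)) :=
              (map_add_le_add p _ _).trans (add_le_add le_rfl (h2 0 (by omega) _))
          _ ≤ p x + U 1 * ((1 - (1 - β) * a 0) * p x) := by gcongr; exact hU 1
          _ = (1 + (1 - (1 - β) * a 0) * U 1) * p x := by ring
          _ ≤ U 0 * p x := mul_le_mul_of_nonneg_right (hrec 0) (apply_nonneg p x)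
      · exact h2 s (by omega) x

/-- The backward recursion says exactly that
$\Delta_s=L_s\Delta_s-L_{s+1}\Delta_{s+1}+a_sL_{s+1}n_s$; the sum telescopes. -/
lemma sum_eq_of_backward_maps {G : V →ₗ[ℝ] V} {a : ℕ → ℝ} {T : ℕ} {L : ℕ → V →ₗ[ℝ] V}
    (h0 : L T = 0) (hL : ∀ s < T, ∀ x, L s x = x + L (s + 1) (x - a s • (x - G x)))
    {Δ n : ℕ → V} (hΔ : ∀ t, Δ (t + 1) = Δ t - a t • (Δ t - G (Δ t)) + a t • n t) :
    ∑ t ∈ Finset.range T, Δ t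
      = L 0 (Δ 0) + ∑ s ∈ Finset.range T, (a s • L (s + 1)) (n s) := by
  have h1 : ∀ s ∈ Finset.range T,
      Δ s = (L s (Δ s) - L (s + 1) (Δ (s + 1))) + (a s • L (s + 1)) (n s) := by
    intro s hs
    rw [hL s (Finset.mem_range.1 hs), hΔ s, map_add, map_smul, LinearMap.smul_apply]
    abel
  rw [Finset.sum_congr rfl h1, Finset.sum_add_distrib,
    Finset.sum_range_sub' (fun s => L s (Δ s)) T, h0]
  simp

lemma sum_lag_le {f : ℕ → ℝ} (hf : ∀ t, 0 ≤ f t) (τ T : ℕ) :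
    ∑ s ∈ Finset.range T, (if τ ≤ s then f (s - τ) else 0) ≤ ∑ r ∈ Finset.range T, f r := by
  have h : ∑ s ∈ Finset.range T, (if τ ≤ s then f (s - τ) else 0)
      = ∑ r ∈ Finset.range (T - τ), f r := by
    induction T with
    | zero => simp
    | succ T ih =>
      rw [Finset.sum_range_succ, ih]
      split_ifs with h
      · rw [Nat.succ_sub h, Finset.sum_range_succ]
      · rw [show T + 1 - τ = T - τ by omega, add_zero]
  rw [h]
  exact Finset.sum_le_sum_of_subset_of_nonneg
    (Finset.range_subset_range.2 (Nat.sub_le T τ)) fun r _ _ => hf r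

lemma seminorm_average_le {p : Seminorm ℝ V} {N : ℕ} (hN : 0 < N) {v : Fin N → V} {c : ℝ}
    (hv : ∀ i, p (v i) ≤ c) : p ((1 / (N : ℝ)) • ∑ i, v i) ≤ c := by
  have hN' : (0 : ℝ) < N := by exact_mod_cast hN
  rw [map_smul_eq_mul, Real.norm_of_nonneg (by positivity), one_div, inv_mul_le_iff₀ hN']
  refine (Finset.le_sum_of_subadditive p (map_zero p).le (map_add_le_add p) _ _).trans ?_
  refine (Finset.sum_le_sum fun i _ => hv i).trans ?_
  simp

lemma seminorm_sum_le {ι : Type*} (p : Seminorm ℝ V) (s : Finset ι) (v : ι → V) :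
    p (∑ i ∈ s, v i) ≤ ∑ i ∈ s, p (v i) :=
  Finset.le_sum_of_subadditive p (map_zero p).le (map_add_le_add p) _ _

end LinearRecursion

/-! ### First moments of noise sums, for one agent and for the average. -/

section Agents

variable {Ω Y : Type*} [MeasurableSpace Y] {mΩ : MeasurableSpace Ω} {μ : Measure Ω}
  [IsProbabilityMeasure μ] {𝓕 : ℕ → MeasurableSpace Ω} {ε M : ℝ} {τ : ℕ}

lemma integral_abs_sum_le_of_mixing {y : ℕ → Ω → Y} {η : Measure Y} [IsProbabilityMeasure η]
    {ψ : ℕ → Y → ℝ} {W : ℕ → Ω → ℝ} (h𝓕 : ∀ t, 𝓕 t ≤ mΩ) (hmono : Monotone 𝓕)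
    (hy𝓕 : ∀ t, Measurable[𝓕 (t + 1)] (y t)) (hM : 0 ≤ M) (hε : 0 ≤ ε)
    (hmix : ∀ t, τ < t → ∀ B : Set Y, MeasurableSet B →
      ∀ᵐ ω ∂μ, |(μ[(y t ⁻¹' B).indicator (fun _ => (1 : ℝ)) | 𝓕 (t - τ)]) ω - η.real B| ≤ ε)
    (hψ : ∀ s, Measurable (ψ s)) (hψM : ∀ s z, |ψ s z| ≤ M) (hψ0 : ∀ s, ∫ z, ψ s z ∂η = 0)
    (hW : ∀ s, Measurable[𝓕 (s - τ)] (W s)) (hWi : ∀ s, Integrable (fun ω => W s ω ^ 2) μ)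
    (T : ℕ) :
    MemLp (fun ω => ∑ s ∈ Finset.range T, ψ s (y s ω) * W s ω) 2 μ ∧
    ∫ ω, |∑ s ∈ Finset.range T, ψ s (y s ω) * W s ω| ∂μ
      ≤ √(M ^ 2 * (2 * τ + 1 + 2 * ε * T) * ∑ s ∈ Finset.range T, ∫ ω, W s ω ^ 2 ∂μ) := by
  have hWm : ∀ s, Measurable (W s) := fun s => (hW s).mono (h𝓕 _) le_rfl
  have hym : ∀ t, Measurable (y t) := fun t => (hy𝓕 t).mono (h𝓕 _) le_rfl
  have ham : ∀ s, AEStronglyMeasurable (fun ω => ψ s (y s ω) * W s ω) μ := fun s =>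
    (((hψ s).comp (hym s)).mul (hWm s)).aestronglyMeasurable
  have hL : MemLp (fun ω => ∑ s ∈ Finset.range T, ψ s (y s ω) * W s ω) 2 μ :=
    memLp_finsetSum _ fun s _ => (memLp_two_iff_integrable_sq (ham s)).2
      (integrable_sq_mul_comp hym hψ hψM s (hWi s))
  refine ⟨hL, (integral_abs_le_sqrt hL.1 hL.integrable_sq).trans ?_⟩
  exact Real.sqrt_le_sqrt
    (integral_sq_sum_le_of_mixing h𝓕 hmono hy𝓕 hM hε hmix hψ hψM hψ0 hW hWi T)

/-- Averaging over independent agents reduces the variance by the number of agents, up to the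
bias. -/
lemma integral_abs_average_le_of_mixing {N : ℕ} (hN : 0 < N) {y : Fin N → ℕ → Ω → Y}
    {η : Fin N → Measure Y} [∀ i, IsProbabilityMeasure (η i)] {φ : Fin N → ℕ → Y → ℝ}
    (h𝓕 : ∀ t, 𝓕 t ≤ mΩ) (hmono : Monotone 𝓕)
    (hy𝓕 : ∀ i t, Measurable[𝓕 (t + 1)] (y i t))
    (hind : iIndepFun (fun i ω t => y i t ω) μ) (hM : 0 ≤ M) (hε : 0 ≤ ε)
    (hmix : ∀ i t, τ < t → ∀ B : Set Y, MeasurableSet B →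
      ∀ᵐ ω ∂μ,
        |(μ[(y i t ⁻¹' B).indicator (fun _ => (1 : ℝ)) | 𝓕 (t - τ)]) ω - (η i).real B| ≤ ε)
    (hφ : ∀ i s, Measurable (φ i s)) (hφM : ∀ i s z, |φ i s z| ≤ M)
    (hφ0 : ∀ i s, ∫ z, φ i s z ∂(η i) = 0) (T : ℕ) :
    Integrable (fun ω => (1 / (N : ℝ)) * ∑ i, ∑ s ∈ Finset.range T, φ i s (y i s ω)) μ ∧
    ∫ ω, |(1 / (N : ℝ)) * ∑ i, ∑ s ∈ Finset.range T, φ i s (y i s ω)| ∂μ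
      ≤ √(M ^ 2 * (2 * τ + 1 + 2 * ε * T) * T / N) + M * (τ + 1 + 2 * ε * T) := by
  have hym : ∀ i t, Measurable (y i t) := fun i t => (hy𝓕 i t).mono (h𝓕 _) le_rfl
  set Z : Fin N → Ω → ℝ := fun i ω => ∑ s ∈ Finset.range T, φ i s (y i s ω) with hZdef
  have hZ : ∀ i, MemLp (Z i) 2 μ := fun i => memLp_finsetSum _ fun s _ =>
    MemLp.of_bound ((hφ i s).comp (hym i s)).aestronglyMeasurable M
      (Filter.Eventually.of_forall fun ω => hφM i s _)
  have hZ2 : ∀ i, ∫ ω, Z i ω ^ 2 ∂μ ≤ M ^ 2 * (2 * τ + 1 + 2 * ε * T) * T := fun i => by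
    have := integral_sq_sum_le_of_mixing (W := fun _ _ => (1 : ℝ)) h𝓕 hmono (hy𝓕 i) hM hε (hmix i)
      (hφ i) (hφM i) (hφ0 i) (fun s => measurable_const) (fun s => by simp) T
    simpa [Z] using this
  have hZ1 : ∀ i, |∫ ω, Z i ω ∂μ| ≤ M * (τ + 1 + 2 * ε * T) := fun i =>
    abs_integral_sum_le_of_mixing h𝓕 (hym i) hM hε (hmix i) (hφ i) (hφM i) (hφ0 i) T
  -- The functions `φ i s` are deterministic, so each `Z i` depends on the path of agent `i` alone.
  -- This is what makes the gain in $N$ possible.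
  have hZind : Pairwise fun i j => IndepFun (Z i) (Z j) μ := by
    intro i j hij
    have hmeas : ∀ i, Measurable fun x : ℕ → Y => ∑ s ∈ Finset.range T, φ i s (x s) := fun i =>
      Finset.measurable_sum _ fun s _ => (hφ i s).comp (measurable_pi_apply s)
    exact (hind.indepFun hij).comp (hmeas i) (hmeas j)
  have hL : MemLp (fun ω => (1 / (N : ℝ)) * ∑ i, Z i ω) 2 μ :=
    (memLp_finsetSum _ fun i _ => hZ i).const_mul _
  refine ⟨hL.integrable one_le_two, (integral_abs_le_sqrt hL.1 hL.integrable_sq).trans ?_⟩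
  refine (Real.sqrt_le_sqrt (integral_sq_average_le hN hZ hZind hZ2 hZ1)).trans ?_
  have hm0 : 0 ≤ M * (τ + 1 + 2 * ε * T) := by positivity
  have hx0 : 0 ≤ M ^ 2 * (2 * τ + 1 + 2 * ε * T) * T / N := by positivity
  refine Real.sqrt_le_iff.2 ⟨by positivity, ?_⟩
  nlinarith [Real.sq_sqrt hx0, mul_nonneg (Real.sqrt_nonneg (M ^ 2 * (2 * τ + 1 + 2 * ε * T) * T / N)) hm0]

end Agents

/-! ### Averages, histories and measurability of the iterates. -/

section Trajectories

variable {d N : ℕ} {Ω Y : Type*} [MeasurableSpace Y]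

lemma smul_runningAverage (Q : ℕ → Ω → (Fin d → ℝ)) (ω : Ω) (T : ℕ) :
    (T : ℝ) • runningAverage Q T ω = ∑ t ∈ Finset.range T, Q t ω := by
  induction T with
  | zero => simp
  | succ T ih =>
    rw [Finset.sum_range_succ, ← ih]
    have hT : ((T : ℝ) + 1) ≠ 0 := by positivity
    simp only [runningAverage]
    push_cast
    rw [smul_add, smul_smul, mul_one_div_cancel hT]
    module

lemma history_mono (Q₀ : Ω → (Fin d → ℝ)) (y : Fin N → ℕ → Ω → Y) : Monotone (history Q₀ y) := by
  intro s t hst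
  refine sup_le_sup le_rfl (iSup_mono fun i => iSup_mono fun k => ?_)
  exact iSup_le fun hk => le_iSup_of_le (hk.trans_le hst) le_rfl

lemma history_le [mΩ : MeasurableSpace Ω] {Q₀ : Ω → (Fin d → ℝ)} {y : Fin N → ℕ → Ω → Y}
    (hQ₀ : Measurable Q₀) (hy : ∀ i t, Measurable (y i t)) (t : ℕ) : history Q₀ y t ≤ mΩ :=
  sup_le hQ₀.comap_le (iSup_le fun i => iSup_le fun k => iSup_le fun _ => (hy i k).comap_le)

lemma measurable_history_obs (Q₀ : Ω → (Fin d → ℝ)) (y : Fin N → ℕ → Ω → Y) (i : Fin N) (t : ℕ) :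
    Measurable[history Q₀ y (t + 1)] (y i t) := by
  refine Measurable.mono (comap_measurable (y i t)) ?_ le_rfl
  refine le_sup_of_le_right (le_iSup_of_le i (le_iSup_of_le t ?_))
  exact le_iSup_of_le (Nat.lt_succ_self t) le_rfl

lemma measurable_history_iterate {h : Fin N → (Fin d → ℝ) → Y → (Fin d → ℝ)}
    (hh : ∀ i, Measurable fun z : (Fin d → ℝ) × Y => h i z.1 z.2) (α : ℝ)
    (Q₀ : Ω → (Fin d → ℝ)) (y : Fin N → ℕ → Ω → Y) (t : ℕ) :
    Measurable[history Q₀ y t] (iterate h α Q₀ y t) := by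
  induction t with
  | zero => exact Measurable.mono (comap_measurable Q₀) le_sup_left le_rfl
  | succ t ih =>
    have hQ := ih.mono (history_mono Q₀ y (Nat.le_succ t)) le_rfl
    have hs : Measurable[history Q₀ y (t + 1)]
        (fun ω => ∑ i, h i (iterate h α Q₀ y t ω) (y i t ω)) :=
      Finset.measurable_sum _ fun i _ =>
        (hh i).comp (hQ.prodMk (measurable_history_obs Q₀ y i t))
    exact hQ.add (((hs.const_smul (1 / (N : ℝ))).sub hQ).const_smul (stepsize α t))

end Trajectories

/-! ### The problem data bundled, and its linearization at the fixed point. -/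

/-- Piecewise-linear stochastic approximation with independent geometrically mixing agents and a
contractive mean operator, around a fixed point `Qs` near which the pieces are constant. -/
structure PiecewiseLinearSA {d N : ℕ} {Ω Y : Type*} [MeasurableSpace Ω] [MeasurableSpace Y]
    (μ : Measure Ω) (p : Seminorm ℝ (Fin d → ℝ)) (h b : Fin N → (Fin d → ℝ) → Y → (Fin d → ℝ))
    (A : Fin N → (Fin d → ℝ) → Y → Matrix (Fin d) (Fin d) ℝ) (η : Fin N → Measure Y)
    (y : Fin N → ℕ → Ω → Y) (Q₀ : Ω → (Fin d → ℝ)) (Qs : Fin d → ℝ)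
    (β C_A C_b C_s C_E ρ R : ℝ) : Prop where
  pos : 0 < N
  indep : iIndepFun (fun i ω t => y i t ω) μ
  meas_obs : ∀ i t, Measurable (y i t)
  meas_init : Measurable Q₀
  prob : ∀ i, IsProbabilityMeasure (η i)
  integrable : ∀ i Q, Integrable (h i Q) (η i)
  contraction : ∀ Q Q', p (meanOp h η Q - meanOp h η Q') ≤ β * p (Q - Q')
  fixed : p (meanOp h η Qs - Qs) = 0
  fixed_le : p Qs ≤ R
  meas_b : ∀ i, Measurable fun z : (Fin d → ℝ) × Y => b i z.1 z.2
  meas_A : ∀ i j k, Measurable fun z : (Fin d → ℝ) × Y => A i z.1 z.2 j k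
  eq : ∀ i Q z, h i Q z = b i Q z + (A i Q z).mulVec Q
  bound_A : ∀ i Q z x, p ((A i Q z).mulVec x) ≤ C_A * p x
  bound_b : ∀ i Q z, p (b i Q z) ≤ C_b
  loc : ∀ i Q z, p (Q - Qs) < C_s → A i Q z = A i Qs z ∧ b i Q z = b i Qs z
  mixing : GeometricMixing μ Q₀ y η C_E ρ
  C_A_pos : 0 < C_A
  C_b_pos : 0 < C_b
  C_s_pos : 0 < C_s
  C_E_pos : 0 < C_E
  contr_lt_one : β < 1
  rate_pos : 0 < ρ

namespace PiecewiseLinearSA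

variable {d N : ℕ} {Ω Y : Type*} [MeasurableSpace Ω] [MeasurableSpace Y]
  {μ : Measure Ω} {p : Seminorm ℝ (Fin d → ℝ)} {h b : Fin N → (Fin d → ℝ) → Y → (Fin d → ℝ)}
  {A : Fin N → (Fin d → ℝ) → Y → Matrix (Fin d) (Fin d) ℝ} {η : Fin N → Measure Y}
  {y : Fin N → ℕ → Ω → Y} {Q₀ : Ω → (Fin d → ℝ)} {Qs : Fin d → ℝ}
  {β C_A C_b C_s C_E ρ R : ℝ}

section Linearization

variable (S : PiecewiseLinearSA μ p h b A η y Q₀ Qs β C_A C_b C_s C_E ρ R)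
include S

lemma meas_mulVec (i : Fin N) {X : Type*} [MeasurableSpace X] {f g : X → (Fin d → ℝ)} {w : X → Y}
    (hf : Measurable f) (hg : Measurable g) (hw : Measurable w) :
    Measurable fun x => (A i (f x) (w x)).mulVec (g x) := by
  refine measurable_pi_lambda _ fun j => ?_
  simp only [Matrix.mulVec, dotProduct]
  exact Finset.measurable_sum _ fun k _ =>
    ((S.meas_A i j k).comp (hf.prodMk hw)).mul ((measurable_pi_apply k).comp hg)

lemma meas_h (i : Fin N) : Measurable fun z : (Fin d → ℝ) × Y => h i z.1 z.2 := by
  simp only [S.eq]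
  exact (S.meas_b i).add (S.meas_mulVec i measurable_fst measurable_fst measurable_snd)

lemma meas_mulVec_fixed (i : Fin N) (x : Fin d → ℝ) :
    Measurable fun z => (A i Qs z).mulVec x :=
  S.meas_mulVec i measurable_const measurable_const measurable_id

lemma bound_h (i : Fin N) (Q : Fin d → ℝ) (z : Y) : p (h i Q z) ≤ C_b + C_A * p Q := by
  rw [S.eq]
  exact (map_add_le_add p _ _).trans (add_le_add (S.bound_b i Q z) (S.bound_A i Q z Q))

lemma sub_eq_mulVec_of_lt (i : Fin N) {x : Fin d → ℝ} (hx : p x < C_s) (z : Y) :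
    h i (Qs + x) z - h i Qs z = (A i Qs z).mulVec x := by
  obtain ⟨hA, hb⟩ := S.loc i (Qs + x) z (by simpa using hx)
  rw [S.eq, S.eq, hA, hb, Matrix.mulVec_add]
  abel

lemma exists_scale (x : Fin d → ℝ) : ∃ c : ℝ, 0 < c ∧ p (c • x) < C_s := by
  have h1 := apply_nonneg p x
  refine ⟨C_s / (p x + 1), div_pos S.C_s_pos (by linarith), ?_⟩
  rw [map_smul_eq_mul, Real.norm_of_nonneg (div_pos S.C_s_pos (by linarith)).le, div_mul_eq_mul_div,
    div_lt_iff₀ (by linarith)]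
  nlinarith [S.C_s_pos]

/-- After scaling $x$ into the ball where the pieces are constant, $A_i(Q^*,\cdot)x$ is a multiple
of a difference of two integrable local updates. -/
lemma integrable_mulVec (i : Fin N) (x : Fin d → ℝ) :
    Integrable (fun z => (A i Qs z).mulVec x) (η i) := by
  obtain ⟨c, hc, hcx⟩ := S.exists_scale x
  have h1 : Integrable (fun z => h i (Qs + c • x) z - h i Qs z) (η i) :=
    (S.integrable i _).sub (S.integrable i _)
  refine (h1.smul c⁻¹).congr (Filter.Eventually.of_forall fun z => ?_)
  change c⁻¹ • (h i (Qs + c • x) z - h i Qs z) = _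
  rw [S.sub_eq_mulVec_of_lt i hcx, Matrix.mulVec_smul, smul_smul, inv_mul_cancel₀ hc.ne', one_smul]

/-- The mean linear map of one agent at the fixed point. -/
lemma exists_agentMean (i : Fin N) :
    ∃ G : (Fin d → ℝ) →ₗ[ℝ] (Fin d → ℝ), ∀ x, G x = ∫ z, (A i Qs z).mulVec x ∂(η i) :=
  ⟨{ toFun := fun x => ∫ z, (A i Qs z).mulVec x ∂(η i)
     map_add' := fun x x' => by
       simp only [Matrix.mulVec_add]
       exact integral_add (S.integrable_mulVec i x) (S.integrable_mulVec i x')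
     map_smul' := fun c x => by
       simp only [Matrix.mulVec_smul, RingHom.id_apply]
       exact integral_smul c _ }, fun _ => rfl⟩

/-- Inside the ball the mean operator differs from its value at $Q^*$ by exactly this linear map;
the contraction passes to it there, and to all $x$ by homogeneity. -/
lemma seminorm_mean_le {G : Fin N → (Fin d → ℝ) →ₗ[ℝ] (Fin d → ℝ)}
    (hG : ∀ i x, G i x = ∫ z, (A i Qs z).mulVec x ∂(η i)) (x : Fin d → ℝ) :
    p ((1 / (N : ℝ)) • ∑ i, G i x) ≤ β * p x := by
  obtain ⟨c, hc, hcx⟩ := S.exists_scale x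
  have h1 := S.contraction (Qs + c • x) Qs
  have h2 : meanOp h η (Qs + c • x) - meanOp h η Qs = c • ((1 / (N : ℝ)) • ∑ i, G i x) := by
    unfold meanOp
    rw [← smul_sub, ← Finset.sum_sub_distrib, smul_comm c, Finset.smul_sum (r := c)]
    congr 1
    refine Finset.sum_congr rfl fun i _ => ?_
    rw [← integral_sub (S.integrable i _) (S.integrable i _), ← map_smul, hG]
    exact integral_congr_ae (Filter.Eventually.of_forall fun z => S.sub_eq_mulVec_of_lt i hcx z)
  rw [h2, add_sub_cancel_left, map_smul_eq_mul p c, map_smul_eq_mul p c,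
    Real.norm_of_nonneg hc.le] at h1
  have h3 : c * p ((1 / (N : ℝ)) • ∑ i, G i x) ≤ c * (β * p x) := by linarith
  exact le_of_mul_le_mul_left h3 hc

omit S in
lemma apply_integral {g : (Fin d → ℝ) →ₗ[ℝ] ℝ} {ν : Measure Y} {f : Y → (Fin d → ℝ)}
    (hf : Integrable f ν) : g (∫ z, f z ∂ν) = ∫ z, g (f z) ∂ν :=
  (g.toContinuousLinearMap.integral_comp_comm hf).symm

omit S in
lemma centered_observable {g : (Fin d → ℝ) →ₗ[ℝ] ℝ} {ν : Measure Y} [IsProbabilityMeasure ν]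
    {f : Y → (Fin d → ℝ)} (hf : Integrable f ν) {c : ℝ} (hc : ∀ z, |g (f z)| ≤ c) :
    (∀ z, |g (f z - ∫ w, f w ∂ν)| ≤ 2 * c) ∧ ∫ z, g (f z - ∫ w, f w ∂ν) ∂ν = 0 := by
  have h1 : |g (∫ w, f w ∂ν)| ≤ c := by
    rw [apply_integral hf]
    have := norm_integral_le_of_norm_le_const (μ := ν) (f := fun z => g (f z)) (C := c)
      (Filter.Eventually.of_forall hc)
    simpa using this
  refine ⟨fun z => ?_, ?_⟩
  · rw [map_sub]
    refine (abs_sub _ _).trans ?_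
    linarith [hc z]
  · rw [← apply_integral (f := fun z => f z - ∫ w, f w ∂ν) (hf.sub (integrable_const _)),
      integral_sub hf (integrable_const _)]
    simp

/-- The remainder of the linearization at the fixed point, averaged over agents. -/
lemma seminorm_remainder_le (Q : Fin d → ℝ) (z : Fin N → Y) :
    p ((1 / (N : ℝ)) • ∑ i, (h i Q (z i) - h i Qs (z i) - (A i Qs (z i)).mulVec (Q - Qs)))
      ≤ 2 * (C_b + C_A * (p (Q - Qs) + R)) ∧
    p ((1 / (N : ℝ)) • ∑ i, (h i Q (z i) - h i Qs (z i) - (A i Qs (z i)).mulVec (Q - Qs)))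
      ≤ 2 * ((C_b + C_A * R) / C_s ^ 2 + C_A / C_s) * p (Q - Qs) ^ 2 := by
  have hR : 0 ≤ R := (apply_nonneg p Qs).trans S.fixed_le
  have hQ : p Q ≤ p (Q - Qs) + R := by
    have := map_add_le_add p (Q - Qs) Qs
    rw [sub_add_cancel] at this
    linarith [S.fixed_le]
  have h1 : p ((1 / (N : ℝ)) • ∑ i, (h i Q (z i) - h i Qs (z i) - (A i Qs (z i)).mulVec (Q - Qs)))
      ≤ 2 * (C_b + C_A * (p (Q - Qs) + R)) := by
    refine seminorm_average_le S.pos fun i => ?_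
    -- The offset $A_i(Q^*,\cdot)Q^*$ cancels, leaving two pieces evaluated at the same point $Q$,
    -- each of linear growth.
    have e : h i Q (z i) - h i Qs (z i) - (A i Qs (z i)).mulVec (Q - Qs)
        = (b i Q (z i) + (A i Q (z i)).mulVec Q) - (b i Qs (z i) + (A i Qs (z i)).mulVec Q) := by
      rw [S.eq, S.eq, Matrix.mulVec_sub]; abel
    rw [e]
    have hbd : ∀ Q', p (b i Q' (z i) + (A i Q' (z i)).mulVec Q)
        ≤ C_b + C_A * (p (Q - Qs) + R) := fun Q' =>
      (map_add_le_add p _ _).trans (add_le_add (S.bound_b i Q' _)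
        ((S.bound_A i Q' _ Q).trans (mul_le_mul_of_nonneg_left hQ S.C_A_pos.le)))
    refine (map_sub_le_add p _ _).trans ?_
    linarith [hbd Q, hbd Qs]
  refine ⟨h1, ?_⟩
  rcases lt_or_ge (p (Q - Qs)) C_s with hlt | hge
  · have e : ∀ i, h i Q (z i) - h i Qs (z i) - (A i Qs (z i)).mulVec (Q - Qs) = 0 := fun i => by
      have := S.sub_eq_mulVec_of_lt i hlt (z i)
      rw [add_sub_cancel] at this
      rw [this, sub_self]
    simp only [e, Finset.sum_const_zero, smul_zero, map_zero]
    have := S.C_A_pos; have := S.C_b_pos; have := S.C_s_pos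
    positivity
  · refine h1.trans ?_
    set x := p (Q - Qs)
    have hs := S.C_s_pos
    -- Outside the ball, powers of $x/C_*\ge1$ upgrade the constant and linear terms to quadratic
    -- ones.
    have e1 : 1 ≤ x / C_s := (one_le_div hs).2 hge
    have e2 : 1 ≤ (x / C_s) ^ 2 := one_le_pow₀ e1
    have e3 : C_b + C_A * R ≤ (C_b + C_A * R) * (x / C_s) ^ 2 := by
      refine le_mul_of_one_le_right ?_ e2
      have := S.C_A_pos; have := S.C_b_pos
      positivity
    have e4 : C_A * x ≤ C_A * x * (x / C_s) := by
      refine le_mul_of_one_le_right ?_ e1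
      have := S.C_A_pos.le
      have : 0 ≤ x := apply_nonneg p _
      positivity
    calc 2 * (C_b + C_A * (x + R)) = 2 * ((C_b + C_A * R) + C_A * x) := by ring
      _ ≤ 2 * ((C_b + C_A * R) * (x / C_s) ^ 2 + C_A * x * (x / C_s)) := by linarith
      _ = _ := by field_simp

lemma seminorm_increment_le {α : ℝ} (t : ℕ) (ω : Ω) :
    p (iterate h α Q₀ y (t + 1) ω - iterate h α Q₀ y t ω)
      ≤ stepsize α t * ((C_b + (C_A + 1) * (R + 1)) * (1 + p (iterate h α Q₀ y t ω - Qs))) := by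
  have hR : 0 ≤ R := (apply_nonneg p Qs).trans S.fixed_le
  set Q := iterate h α Q₀ y t ω with hQdef
  have e : iterate h α Q₀ y (t + 1) ω - Q
      = stepsize α t • ((1 / (N : ℝ)) • (∑ i, h i Q (y i t ω)) - Q) := by
    simp [iterate, hQdef]
  have hQ : p Q ≤ p (Q - Qs) + R := by
    have := map_add_le_add p (Q - Qs) Qs
    rw [sub_add_cancel] at this
    linarith [S.fixed_le]
  rw [e, map_smul_eq_mul, Real.norm_of_nonneg (stepsize_pos α t).le]
  refine mul_le_mul_of_nonneg_left ?_ (stepsize_pos α t).le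
  refine (map_sub_le_add p _ _).trans ?_
  have h1 := seminorm_average_le (p := p) S.pos fun i => S.bound_h i Q (y i t ω)
  have h0 : 0 ≤ p (Q - Qs) := apply_nonneg p _
  have hA := S.C_A_pos
  have hb := S.C_b_pos
  calc _ ≤ C_b + (C_A + 1) * p Q := by linarith
    _ ≤ C_b + (C_A + 1) * (p (Q - Qs) + R) := by gcongr
    _ ≤ (C_b + (C_A + 1) * (R + 1)) * (1 + p (Q - Qs)) := by
      have : 0 ≤ C_b * p (Q - Qs) + (C_A + 1) * (1 + R * p (Q - Qs)) := by positivity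
      nlinarith

end Linearization

/-! ### Moments of the deviation, of its increments and of the remainder. -/

section Moments

variable (S : PiecewiseLinearSA μ p h b A η y Q₀ Qs β C_A C_b C_s C_E ρ R)
include S

lemma drift_const_pos : 0 < C_b + (C_A + 1) * (R + 1) := by
  have hR : 0 ≤ R := (apply_nonneg p Qs).trans S.fixed_le
  have := S.C_A_pos; have := S.C_b_pos
  positivity

lemma meas_iterate (α : ℝ) (t : ℕ) : Measurable (iterate h α Q₀ y t) :=
  (measurable_history_iterate S.meas_h α Q₀ y t).mono (history_le S.meas_init S.meas_obs t) le_rfl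

lemma meas_dist (α : ℝ) (t : ℕ) : Measurable fun ω => p (iterate h α Q₀ y t ω - Qs) :=
  (seminorm_continuous p).measurable.comp ((S.meas_iterate α t).sub_const Qs)

variable {α : ℝ}

lemma dist_succ_le (hα : 0 ≤ α) (t : ℕ) (ω : Ω) :
    1 + p (iterate h α Q₀ y (t + 1) ω - Qs)
      ≤ (1 + (C_b + (C_A + 1) * (R + 1))) * (1 + p (iterate h α Q₀ y t ω - Qs)) := by
  have h1 := S.seminorm_increment_le (α := α) t ω
  have h2 := map_add_le_add p (iterate h α Q₀ y (t + 1) ω - iterate h α Q₀ y t ω)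
    (iterate h α Q₀ y t ω - Qs)
  rw [sub_add_sub_cancel] at h2
  have h3 : 0 ≤ (C_b + (C_A + 1) * (R + 1)) * (1 + p (iterate h α Q₀ y t ω - Qs)) :=
    mul_nonneg S.drift_const_pos.le (by linarith [apply_nonneg p (iterate h α Q₀ y t ω - Qs)])
  have h4 := mul_le_of_le_one_left h3 (stepsize_le_one hα t)
  linarith

variable [IsProbabilityMeasure μ]

lemma integrable_dist (hα : 0 ≤ α) (h0 : Integrable (fun ω => p (Q₀ ω - Qs)) μ) (t : ℕ) :
    Integrable (fun ω => p (iterate h α Q₀ y t ω - Qs)) μ := by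
  induction t with
  | zero => exact h0
  | succ t ih =>
    refine Integrable.mono' (((integrable_const 1).add ih).const_mul
      (1 + (C_b + (C_A + 1) * (R + 1)))) (S.meas_dist α _).aestronglyMeasurable
      (Filter.Eventually.of_forall fun ω => ?_)
    rw [Real.norm_of_nonneg (apply_nonneg p _)]
    have := S.dist_succ_le hα t ω
    change _ ≤ (1 + (C_b + (C_A + 1) * (R + 1))) * (1 + p (iterate h α Q₀ y t ω - Qs))
    linarith

lemma integral_dist_le_pow (hα : 0 ≤ α) (h0 : Integrable (fun ω => p (Q₀ ω - Qs)) μ) {R₀ : ℝ}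
    (hR₀ : ∫ ω, p (Q₀ ω - Qs) ∂μ ≤ R₀) (t : ℕ) :
    ∫ ω, (1 + p (iterate h α Q₀ y t ω - Qs)) ∂μ
      ≤ (1 + (C_b + (C_A + 1) * (R + 1))) ^ t * (1 + R₀) := by
  have hi : ∀ t, Integrable (fun ω => 1 + p (iterate h α Q₀ y t ω - Qs)) μ := fun t =>
    (integrable_const 1).add (S.integrable_dist hα h0 t)
  induction t with
  | zero =>
    rw [integral_add (integrable_const 1) (S.integrable_dist hα h0 0)]
    simpa [iterate] using hR₀
  | succ t ih =>
    have hc := S.drift_const_pos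
    calc _ ≤ ∫ ω, (1 + (C_b + (C_A + 1) * (R + 1))) * (1 + p (iterate h α Q₀ y t ω - Qs)) ∂μ :=
          integral_mono (hi _) ((hi t).const_mul _) fun ω => S.dist_succ_le hα t ω
      _ ≤ (1 + (C_b + (C_A + 1) * (R + 1)))
            * ((1 + (C_b + (C_A + 1) * (R + 1))) ^ t * (1 + R₀)) := by
          rw [integral_const_mul]; gcongr
      _ = _ := by ring

/-- Up to the burn-in the first moment is multiplied by at most a fixed factor per step, since
$\alpha_t\le1$; afterwards (A4) takes over through $1+x\le2+x^2$. -/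
lemma integral_dist_le (hα : 0 ≤ α) (h0 : Integrable (fun ω => p (Q₀ ω - Qs)) μ) {R₀ C_Q D : ℝ}
    (hR₀ : ∫ ω, p (Q₀ ω - Qs) ∂μ ≤ R₀) (hCQ : 0 ≤ C_Q)
    (hD : ∀ t : ℕ, (mixTime ρ α t : ℝ) * stepsize α t ≤ D)
    (hrate : RawIterateRate μ p (iterate h α Q₀ y) Qs ρ α C_Q) (t : ℕ) :
    ∫ ω, (1 + p (iterate h α Q₀ y t ω - Qs)) ∂μ
      ≤ (1 + (C_b + (C_A + 1) * (R + 1))) ^ burnIn ρ α * (1 + R₀) + (2 + C_Q * D) := by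
  have hc := S.drift_const_pos
  have hR₀' : 0 ≤ R₀ := (integral_nonneg fun ω => apply_nonneg p _).trans hR₀
  have hD0 : 0 ≤ D := le_trans (mul_nonneg (Nat.cast_nonneg _) (stepsize_pos α 0).le) (hD 0)
  have hi := S.integrable_dist hα h0 t
  rcases le_or_gt t (burnIn ρ α) with ht | ht
  · refine (S.integral_dist_le_pow hα h0 hR₀ t).trans ?_
    have h1 : (1 + (C_b + (C_A + 1) * (R + 1))) ^ t ≤ (1 + (C_b + (C_A + 1) * (R + 1))) ^ burnIn ρ α :=
      pow_le_pow_right₀ (by linarith) ht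
    have h2 := mul_le_mul_of_nonneg_right h1 (show (0 : ℝ) ≤ 1 + R₀ by linarith)
    have : 0 ≤ C_Q * D := by positivity
    linarith
  · obtain ⟨hi2, hb⟩ := hrate t ht
    have h1 : ∫ ω, (1 + p (iterate h α Q₀ y t ω - Qs)) ∂μ
        ≤ ∫ ω, (2 + p (iterate h α Q₀ y t ω - Qs) ^ 2) ∂μ := by
      refine integral_mono ((integrable_const 1).add hi) ((integrable_const 2).add hi2) fun ω => ?_
      change 1 + p (iterate h α Q₀ y t ω - Qs) ≤ 2 + p (iterate h α Q₀ y t ω - Qs) ^ 2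
      nlinarith [sq_nonneg (p (iterate h α Q₀ y t ω - Qs) - 1)]
    rw [integral_add (integrable_const 2) hi2, integral_const, probReal_univ, one_smul] at h1
    have h2 : C_Q * (mixTime ρ α t : ℝ) * stepsize α t ≤ C_Q * D := by
      rw [mul_assoc]; exact mul_le_mul_of_nonneg_left (hD t) hCQ
    have h3 : 0 ≤ (1 + (C_b + (C_A + 1) * (R + 1))) ^ burnIn ρ α * (1 + R₀) := by positivity
    linarith

/-- Each of the `n` increments has mean at most $\alpha_r$ times a constant, because the step sizes
decrease and the first moments are bounded by `B`. With `n` equal to $\tau_T$ this is the price of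
lagging the deviation. -/
lemma integral_lag_le (hα : 0 ≤ α) (h0 : Integrable (fun ω => p (Q₀ ω - Qs)) μ) {B : ℝ}
    (hB : ∀ t, ∫ ω, (1 + p (iterate h α Q₀ y t ω - Qs)) ∂μ ≤ B) (r n : ℕ) :
    Integrable (fun ω => p (iterate h α Q₀ y (r + n) ω - iterate h α Q₀ y r ω)) μ ∧
    ∫ ω, p (iterate h α Q₀ y (r + n) ω - iterate h α Q₀ y r ω) ∂μ
      ≤ n * (stepsize α r * ((C_b + (C_A + 1) * (R + 1)) * B)) := by
  have hc := S.drift_const_pos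
  have hm : ∀ n, Measurable fun ω => p (iterate h α Q₀ y (r + n) ω - iterate h α Q₀ y r ω) :=
    fun n => (seminorm_continuous p).measurable.comp
      ((S.meas_iterate α (r + n)).sub (S.meas_iterate α r))
  have hd : ∀ t, Integrable (fun ω => (C_b + (C_A + 1) * (R + 1)) *
      (1 + p (iterate h α Q₀ y t ω - Qs))) μ := fun t =>
    ((integrable_const 1).add (S.integrable_dist hα h0 t)).const_mul _
  induction n with
  | zero => simp
  | succ n ih =>
    obtain ⟨ih1, ih2⟩ := ih
    have hstep : ∀ ω, p (iterate h α Q₀ y (r + (n + 1)) ω - iterate h α Q₀ y r ω)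
        ≤ p (iterate h α Q₀ y (r + n) ω - iterate h α Q₀ y r ω)
          + stepsize α r * ((C_b + (C_A + 1) * (R + 1)) *
            (1 + p (iterate h α Q₀ y (r + n) ω - Qs))) := by
      intro ω
      have h1 := S.seminorm_increment_le (α := α) (r + n) ω
      have h2 := map_add_le_add p (iterate h α Q₀ y (r + n + 1) ω - iterate h α Q₀ y (r + n) ω)
        (iterate h α Q₀ y (r + n) ω - iterate h α Q₀ y r ω)
      rw [sub_add_sub_cancel] at h2
      have h3 : 0 ≤ (C_b + (C_A + 1) * (R + 1)) * (1 + p (iterate h α Q₀ y (r + n) ω - Qs)) :=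
        mul_nonneg hc.le (by linarith [apply_nonneg p (iterate h α Q₀ y (r + n) ω - Qs)])
      have h4 := mul_le_mul_of_nonneg_right (stepsize_antitone hα (Nat.le_add_right r n)) h3
      rw [← add_assoc]
      linarith
    have hi2 := ih1.add ((hd (r + n)).const_mul (stepsize α r))
    have hi : Integrable (fun ω => p (iterate h α Q₀ y (r + (n + 1)) ω - iterate h α Q₀ y r ω)) μ :=
      Integrable.mono' hi2 (hm (n + 1)).aestronglyMeasurable
        (Filter.Eventually.of_forall fun ω => by
          rw [Real.norm_of_nonneg (apply_nonneg p _)]; exact hstep ω)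
    refine ⟨hi, (integral_mono hi hi2 hstep).trans ?_⟩
    simp only [Pi.add_apply]
    rw [integral_add ih1 ((hd (r + n)).const_mul _), integral_const_mul, integral_const_mul]
    have h5 : stepsize α r * ((C_b + (C_A + 1) * (R + 1)) *
        ∫ ω, (1 + p (iterate h α Q₀ y (r + n) ω - Qs)) ∂μ)
        ≤ stepsize α r * ((C_b + (C_A + 1) * (R + 1)) * B) := by
      have := stepsize_pos α r
      gcongr
      exact hB _
    push_cast
    linarith

/-- Total remainder of the linearization along the trajectory. -/
lemma integral_remainder_le (hα : 0 ≤ α) (hρ : ρ ∈ Set.Ioo (0 : ℝ) 1)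
    (h0 : Integrable (fun ω => p (Q₀ ω - Qs)) μ) {B C_Q : ℝ} (hCQ : 0 ≤ C_Q)
    (hB : ∀ t, ∫ ω, (1 + p (iterate h α Q₀ y t ω - Qs)) ∂μ ≤ B)
    (hrate : RawIterateRate μ p (iterate h α Q₀ y) Qs ρ α C_Q) (T : ℕ) :
    ∃ r : ℕ → Ω → ℝ, (∀ s ω, p ((1 / (N : ℝ)) • ∑ i, (h i (iterate h α Q₀ y s ω) (y i s ω)
        - h i Qs (y i s ω) - (A i Qs (y i s ω)).mulVec (iterate h α Q₀ y s ω - Qs))) ≤ r s ω) ∧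
      (∀ s, Integrable (r s) μ) ∧
      ∑ s ∈ Finset.range T, ∫ ω, r s ω ∂μ ≤ 2 * (C_b + (C_A + 1) * (R + 1)) * B * (burnIn ρ α + 1)
        + 2 * ((C_b + C_A * R) / C_s ^ 2 + C_A / C_s) * C_Q * mixTime ρ α T
          * ∑ s ∈ Finset.range T, stepsize α s := by
  have hR : 0 ≤ R := (apply_nonneg p Qs).trans S.fixed_le
  have hA := S.C_A_pos
  have hb := S.C_b_pos
  have hs := S.C_s_pos
  have hc := S.drift_const_pos
  set κ := 2 * ((C_b + C_A * R) / C_s ^ 2 + C_A / C_s) with hκ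
  have hκ0 : 0 ≤ κ := by positivity
  set c := C_b + (C_A + 1) * (R + 1) with hcdef
  have hB0 : 0 ≤ B := (integral_nonneg fun ω => by
    have := apply_nonneg p (iterate h α Q₀ y 0 ω - Qs)
    change 0 ≤ 1 + p _; linarith).trans (hB 0)
  -- Up to the burn-in only first moments are available, so the linear bound is used; the quadratic
  -- bound is used once (A4) applies.
  set r : ℕ → Ω → ℝ := fun s ω =>
    if s ≤ burnIn ρ α then 2 * c * (1 + p (iterate h α Q₀ y s ω - Qs))
    else κ * p (iterate h α Q₀ y s ω - Qs) ^ 2 with hr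
  have hi1 : ∀ s, Integrable (fun ω => 1 + p (iterate h α Q₀ y s ω - Qs)) μ := fun s =>
    (integrable_const 1).add (S.integrable_dist hα h0 s)
  refine ⟨r, fun s ω => ?_, fun s => ?_, ?_⟩
  · obtain ⟨h1, h2⟩ := S.seminorm_remainder_le (iterate h α Q₀ y s ω) (fun i => y i s ω)
    by_cases hsb : s ≤ burnIn ρ α
    · simp only [hr, if_pos hsb]
      refine h1.trans ?_
      have h3 : 0 ≤ p (iterate h α Q₀ y s ω - Qs) := apply_nonneg p _
      have h4 : C_b + C_A * (p (iterate h α Q₀ y s ω - Qs) + R)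
          ≤ c * (1 + p (iterate h α Q₀ y s ω - Qs)) := by
        have : 0 ≤ C_b * p (iterate h α Q₀ y s ω - Qs)
          + C_A * R * p (iterate h α Q₀ y s ω - Qs)
          + (R + 1) * (1 + p (iterate h α Q₀ y s ω - Qs)) + C_A := by positivity
        rw [hcdef]; nlinarith
      linarith
    · simp only [hr, if_neg hsb]
      exact h2
  · by_cases hsb : s ≤ burnIn ρ α
    · simp only [hr, if_pos hsb]
      exact (hi1 s).const_mul _
    · simp only [hr, if_neg hsb]
      exact (hrate s (not_le.1 hsb)).1.const_mul _
  · have hbound : ∀ s ∈ Finset.range T, ∫ ω, r s ω ∂μ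
        ≤ (if s ∈ Finset.range (burnIn ρ α + 1) then 2 * c * B else 0)
          + κ * C_Q * mixTime ρ α T * stepsize α s := by
      intro s hsT
      have hpos : 0 ≤ κ * C_Q * mixTime ρ α T * stepsize α s := by
        have := stepsize_pos α s; positivity
      by_cases hsb : s ≤ burnIn ρ α
      · simp only [hr, if_pos hsb, if_pos (Finset.mem_range.2 (Nat.lt_succ_of_le hsb))]
        rw [integral_const_mul]
        have : 2 * c * ∫ ω, (1 + p (iterate h α Q₀ y s ω - Qs)) ∂μ ≤ 2 * c * B := by
          gcongr; exact hB s
        linarith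
      · have hsb' : s ∉ Finset.range (burnIn ρ α + 1) := by
          simp only [Finset.mem_range]; omega
        simp only [hr, if_neg hsb, if_neg hsb', zero_add]
        rw [integral_const_mul]
        have h1 := (hrate s (not_le.1 hsb)).2
        have h2 : (mixTime ρ α s : ℝ) ≤ mixTime ρ α T := by
          exact_mod_cast mixTime_mono hρ hα (Finset.mem_range.1 hsT).le
        have := stepsize_pos α s
        calc _ ≤ κ * (C_Q * mixTime ρ α s * stepsize α s) := by gcongr
          _ ≤ κ * (C_Q * mixTime ρ α T * stepsize α s) := by gcongr
          _ = _ := by ring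
    refine (Finset.sum_le_sum hbound).trans ?_
    rw [Finset.sum_add_distrib, ← Finset.mul_sum, ← Finset.sum_filter, Finset.sum_const,
      nsmul_eq_mul]
    have hcard : ((Finset.range T).filter (fun s => s ∈ Finset.range (burnIn ρ α + 1))).card
        ≤ burnIn ρ α + 1 := by
      refine (Finset.card_le_card (t := Finset.range (burnIn ρ α + 1)) ?_).trans (by simp)
      intro s hs; exact (Finset.mem_filter.1 hs).2
    have hcard' : (((Finset.range T).filter
        (fun s => s ∈ Finset.range (burnIn ρ α + 1))).card : ℝ) ≤ burnIn ρ α + 1 := by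
      exact_mod_cast hcard
    have := mul_le_mul_of_nonneg_right hcard' (show 0 ≤ 2 * c * B by positivity)
    linarith

/-- Replacing the deviation at time `s` by the deviation `τ_T` steps earlier, outside of an initial
phase, gives a process that is measurable with lag `τ_T`, is small in mean square, and is close to
the deviation in mean. -/
lemma exists_lagged_deviation (hα : 0 ≤ α) (hρ : ρ ∈ Set.Ioo (0 : ℝ) 1)
    (h0 : Integrable (fun ω => p (Q₀ ω - Qs)) μ) {B C_Q : ℝ} (hCQ : 0 ≤ C_Q)
    (hB : ∀ t, ∫ ω, (1 + p (iterate h α Q₀ y t ω - Qs)) ∂μ ≤ B)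
    (hrate : RawIterateRate μ p (iterate h α Q₀ y) Qs ρ α C_Q) (T : ℕ) :
    ∃ X : ℕ → Ω → (Fin d → ℝ),
      (∀ s, Measurable[history Q₀ y (s - mixTime ρ α T)] (X s)) ∧
      (∀ s, Integrable (fun ω => p (X s ω) ^ 2) μ) ∧
      ∑ s ∈ Finset.range T, ∫ ω, p (X s ω) ^ 2 ∂μ
        ≤ C_Q * mixTime ρ α T * ∑ s ∈ Finset.range T, stepsize α s ∧
      (∀ s, Integrable (fun ω => p (iterate h α Q₀ y s ω - Qs - X s ω)) μ) ∧
      ∑ s ∈ Finset.range T, ∫ ω, p (iterate h α Q₀ y s ω - Qs - X s ω) ∂μ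
        ≤ B * (burnIn ρ α + mixTime ρ α T + 1) + (C_b + (C_A + 1) * (R + 1)) * B * mixTime ρ α T
          * ∑ s ∈ Finset.range T, stepsize α s := by
  have hc := S.drift_const_pos
  set c := C_b + (C_A + 1) * (R + 1) with hcdef
  have hB0 : 0 ≤ B := (integral_nonneg fun ω => by
    have := apply_nonneg p (iterate h α Q₀ y 0 ω - Qs)
    change 0 ≤ 1 + p _; linarith).trans (hB 0)
  set τ := mixTime ρ α T with hτ
  set t₀ := burnIn ρ α
  -- The threshold makes $s-\tau$ exceed the burn-in, so (A4) controls the lagged deviation. Before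
  -- it the second moment need not be finite, and 0 is taken instead.
  set X : ℕ → Ω → (Fin d → ℝ) := fun s ω =>
    if t₀ + τ < s then iterate h α Q₀ y (s - τ) ω - Qs else 0 with hX
  have hXp : ∀ s, t₀ + τ < s → X s = fun ω => iterate h α Q₀ y (s - τ) ω - Qs := fun s hs => by
    simp only [hX, if_pos hs]
  have hXn : ∀ s, ¬ t₀ + τ < s → X s = fun _ => 0 := fun s hs => by
    simp only [hX, if_neg hs]
  have hS := sum_lag_le (f := stepsize α) (fun t => (stepsize_pos α t).le) τ T
  refine ⟨X, fun s => ?_, fun s => ?_, ?_, fun s => ?_, ?_⟩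
  · by_cases hs : t₀ + τ < s
    · rw [hXp s hs]
      exact (measurable_history_iterate S.meas_h α Q₀ y (s - τ)).sub_const Qs
    · rw [hXn s hs]; exact measurable_const
  · by_cases hs : t₀ + τ < s
    · simp only [hXp s hs]
      exact (hrate (s - τ) (by omega)).1
    · simp [hXn s hs]
  · have hbound : ∀ s ∈ Finset.range T, ∫ ω, p (X s ω) ^ 2 ∂μ
        ≤ C_Q * τ * (if τ ≤ s then stepsize α (s - τ) else 0) := by
      intro s hsT
      by_cases hs : t₀ + τ < s
      · simp only [hXp s hs, if_pos (show τ ≤ s by omega)]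
        refine (hrate (s - τ) (by omega)).2.trans ?_
        have h2 : (mixTime ρ α (s - τ) : ℝ) ≤ τ := by
          have := Finset.mem_range.1 hsT
          exact_mod_cast mixTime_mono hρ hα (show s - τ ≤ T by omega)
        have := stepsize_pos α (s - τ)
        gcongr
      · simp only [hXn s hs, map_zero]
        have := stepsize_pos α (s - τ)
        rw [show ∫ _ : Ω, (0 : ℝ) ^ 2 ∂μ = 0 by simp]
        split_ifs <;> positivity
    refine (Finset.sum_le_sum hbound).trans ?_
    rw [← Finset.mul_sum]
    gcongr
  · by_cases hs : t₀ + τ < s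
    · simp only [hXp s hs, sub_sub_sub_cancel_right]
      have := (S.integral_lag_le hα h0 hB (s - τ) τ).1
      rwa [Nat.sub_add_cancel (by omega)] at this
    · simp only [hXn s hs, sub_zero]
      exact S.integrable_dist hα h0 s
  · have hbound : ∀ s ∈ Finset.range T, ∫ ω, p (iterate h α Q₀ y s ω - Qs - X s ω) ∂μ
        ≤ (if s ∈ Finset.range (t₀ + τ + 1) then B else 0)
          + c * B * τ * (if τ ≤ s then stepsize α (s - τ) else 0) := by
      intro s _
      have hpos : 0 ≤ c * B * τ * (if τ ≤ s then stepsize α (s - τ) else 0) := by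
        have := stepsize_pos α (s - τ)
        split_ifs <;> positivity
      by_cases hs : t₀ + τ < s
      · have hs' : s ∉ Finset.range (t₀ + τ + 1) := by simp only [Finset.mem_range]; omega
        simp only [hXp s hs, sub_sub_sub_cancel_right, if_neg hs', if_pos (show τ ≤ s by omega)]
        have := (S.integral_lag_le hα h0 hB (s - τ) τ).2
        rw [Nat.sub_add_cancel (by omega)] at this
        refine this.trans (le_of_eq ?_)
        ring
      · have hs' : s ∈ Finset.range (t₀ + τ + 1) := by simp only [Finset.mem_range]; omega
        rw [if_pos hs']
        simp only [hXn s hs, sub_zero]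
        have h1 := hB s
        rw [integral_add (integrable_const 1) (S.integrable_dist hα h0 s), integral_const,
          probReal_univ, one_smul] at h1
        linarith
    refine (Finset.sum_le_sum hbound).trans ?_
    rw [Finset.sum_add_distrib, ← Finset.mul_sum, ← Finset.sum_filter, Finset.sum_const,
      nsmul_eq_mul]
    have hcard : ((Finset.range T).filter (fun s => s ∈ Finset.range (t₀ + τ + 1))).card
        ≤ t₀ + τ + 1 := by
      refine (Finset.card_le_card (t := Finset.range (t₀ + τ + 1)) ?_).trans (by simp)
      intro s hs; exact (Finset.mem_filter.1 hs).2
    have hcard' : (((Finset.range T).filter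
        (fun s => s ∈ Finset.range (t₀ + τ + 1))).card : ℝ) ≤ t₀ + τ + 1 := by
      exact_mod_cast hcard
    have h1 := mul_le_mul_of_nonneg_right hcard' hB0
    have h2 := mul_le_mul_of_nonneg_left hS (show 0 ≤ c * B * τ by positivity)
    linarith

end Moments

/-! ### Additive and multiplicative noise. -/

section Fluctuations

variable (S : PiecewiseLinearSA μ p h b A η y Q₀ Qs β C_A C_b C_s C_E ρ R)
include S

omit S in
lemma measurable_linearMap (g : (Fin d → ℝ) →ₗ[ℝ] ℝ) : Measurable g :=
  g.continuous_of_finiteDimensional.measurable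

lemma mixing_at (τ : ℕ) (i : Fin N) (t : ℕ) (ht : τ < t) (B : Set Y) (hB : MeasurableSet B) :
    ∀ᵐ ω ∂μ, |(μ[(y i t ⁻¹' B).indicator (fun _ => (1 : ℝ)) | history Q₀ y (t - τ)]) ω
      - (η i).real B| ≤ C_E * ρ ^ τ :=
  S.mixing i t τ ht B hB

variable [IsProbabilityMeasure μ]

/-- The additive noise at the fixed point, tested against deterministic functionals. -/
lemma integral_abs_noise_le {g : ℕ → (Fin d → ℝ) →ₗ[ℝ] ℝ} {c : ℝ} (hc : 0 ≤ c)
    (hg : ∀ s v, |g s v| ≤ c * p v) (τ T : ℕ) :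
    Integrable (fun ω => (1 / (N : ℝ)) * ∑ i, ∑ s ∈ Finset.range T,
      g s (h i Qs (y i s ω) - ∫ w, h i Qs w ∂(η i))) μ ∧
    ∫ ω, |(1 / (N : ℝ)) * ∑ i, ∑ s ∈ Finset.range T,
        g s (h i Qs (y i s ω) - ∫ w, h i Qs w ∂(η i))| ∂μ
      ≤ √((2 * (c * (C_b + C_A * R))) ^ 2 * (2 * τ + 1 + 2 * (C_E * ρ ^ τ) * T) * T / N)
        + 2 * (c * (C_b + C_A * R)) * (τ + 1 + 2 * (C_E * ρ ^ τ) * T) := by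
  have := S.prob
  have hR : 0 ≤ R := (apply_nonneg p Qs).trans S.fixed_le
  have hA := S.C_A_pos
  have hb := S.C_b_pos
  have hE := S.C_E_pos
  have hρ := S.rate_pos
  have hbd : ∀ i s z, |g s (h i Qs z)| ≤ c * (C_b + C_A * R) := fun i s z => by
    refine (hg s _).trans (mul_le_mul_of_nonneg_left ((S.bound_h i Qs z).trans ?_) hc)
    have := mul_le_mul_of_nonneg_left S.fixed_le hA.le
    linarith
  have hcen := fun i s => centered_observable (g := g s) (S.integrable i Qs) (hbd i s)
  refine integral_abs_average_le_of_mixing (𝓕 := history Q₀ y) S.pos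
    (φ := fun i s z => g s (h i Qs z - ∫ w, h i Qs w ∂(η i)))
    (history_le S.meas_init S.meas_obs) (history_mono Q₀ y) (measurable_history_obs Q₀ y)
    S.indep (by positivity) (by positivity) (S.mixing_at τ) ?_
    (fun i s => (hcen i s).1) (fun i s => (hcen i s).2) T
  intro i s
  exact (measurable_linearMap (g s)).comp
    (((S.meas_h i).comp (measurable_const.prodMk measurable_id)).sub_const _)

/-- The multiplicative noise of one agent along a lagged process, tested against deterministic
functionals. -/
lemma integral_abs_multiplicative_noise_le {g : ℕ → (Fin d → ℝ) →ₗ[ℝ] ℝ} {c : ℝ} (hc : 0 ≤ c)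
    (hg : ∀ s v, |g s v| ≤ c * p v) {x : Fin d → ℝ} (hx : p x ≤ 1) {f : (Fin d → ℝ) →ₗ[ℝ] ℝ}
    {F : ℝ} (hf : ∀ v, |f v| ≤ F * p v) {τ : ℕ} {X : ℕ → Ω → (Fin d → ℝ)}
    (hX : ∀ s, Measurable[history Q₀ y (s - τ)] (X s))
    (hX2 : ∀ s, Integrable (fun ω => p (X s ω) ^ 2) μ) (i : Fin N) (T : ℕ) :
    Integrable (fun ω => |∑ s ∈ Finset.range T,
      g s ((A i Qs (y i s ω)).mulVec x - ∫ w, (A i Qs w).mulVec x ∂(η i)) * f (X s ω)|) μ ∧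
    ∫ ω, |∑ s ∈ Finset.range T,
        g s ((A i Qs (y i s ω)).mulVec x - ∫ w, (A i Qs w).mulVec x ∂(η i)) * f (X s ω)| ∂μ
      ≤ √((2 * (c * C_A)) ^ 2 * (2 * τ + 1 + 2 * (C_E * ρ ^ τ) * T)
          * (F ^ 2 * ∑ s ∈ Finset.range T, ∫ ω, p (X s ω) ^ 2 ∂μ)) := by
  have := S.prob
  have hA := S.C_A_pos
  have hE := S.C_E_pos
  have hρ := S.rate_pos
  have hbd : ∀ s z, |g s ((A i Qs z).mulVec x)| ≤ c * C_A := fun s z => by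
    refine (hg s _).trans (mul_le_mul_of_nonneg_left ((S.bound_A i Qs z x).trans ?_) hc)
    exact mul_le_of_le_one_right hA.le hx
  have hcen := fun s => centered_observable (g := g s) (S.integrable_mulVec i x) (hbd s)
  have hXm : ∀ s, Measurable (X s) := fun s =>
    (hX s).mono (history_le S.meas_init S.meas_obs _) le_rfl
  have hsq : ∀ s ω, f (X s ω) ^ 2 ≤ F ^ 2 * p (X s ω) ^ 2 := fun s ω => by
    rw [← mul_pow, ← sq_abs]
    exact pow_le_pow_left₀ (abs_nonneg _) (hf _) 2
  have hWi : ∀ s, Integrable (fun ω => f (X s ω) ^ 2) μ := fun s =>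
    Integrable.mono' ((hX2 s).const_mul (F ^ 2))
      (((measurable_linearMap f).comp (hXm s)).pow_const 2).aestronglyMeasurable
      (Filter.Eventually.of_forall fun ω => by
        rw [Real.norm_of_nonneg (sq_nonneg _)]; exact hsq s ω)
  obtain ⟨h1, h2⟩ := integral_abs_sum_le_of_mixing (𝓕 := history Q₀ y) (τ := τ)
    (ψ := fun s z => g s ((A i Qs z).mulVec x - ∫ w, (A i Qs w).mulVec x ∂(η i)))
    (W := fun s ω => f (X s ω))
    (history_le S.meas_init S.meas_obs) (history_mono Q₀ y) (measurable_history_obs Q₀ y i)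
    (by positivity) (by positivity) (S.mixing_at τ i)
    (fun s => (measurable_linearMap (g s)).comp ((S.meas_mulVec_fixed i x).sub_const _))
    (fun s => (hcen s).1) (fun s => (hcen s).2)
    (fun s => (measurable_linearMap f).comp (hX s)) hWi T
  refine ⟨(h1.integrable one_le_two).abs, h2.trans (Real.sqrt_le_sqrt ?_)⟩
  refine mul_le_mul_of_nonneg_left ?_ (by positivity)
  rw [Finset.mul_sum]
  refine Finset.sum_le_sum fun s _ => ?_
  rw [← integral_const_mul]
  exact integral_mono (hWi s) ((hX2 s).const_mul _) (hsq s)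

end Fluctuations

/-! ### Pathwise decomposition of the summed deviations. -/

section Decomposition

variable (S : PiecewiseLinearSA μ p h b A η y Q₀ Qs β C_A C_b C_s C_E ρ R)
include S

/-- Pathwise bound of the summed deviations by the noise at the fixed point, the multiplicative
noise along an arbitrary process `X`, the distance to `X`, and the linearization remainder. -/
lemma seminorm_sum_deviation_le {α : ℝ} (hα : α ∈ Set.Ioo (1 / 2 : ℝ) 1) {U : ℕ → ℝ} {K F : ℝ}
    (hU : ∀ s, 0 ≤ U s) (hU0 : U 0 ≤ K)
    (hUK : ∀ s, stepsize α s * U (s + 1) ≤ K)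
    (hUrec : ∀ s, 1 + (1 - (1 - β) * stepsize α s) * U (s + 1) ≤ U s)
    {f : Fin d → (Fin d → ℝ) →ₗ[ℝ] ℝ} {x : Fin d → (Fin d → ℝ)} (hx : ∀ k, p (x k) ≤ 1)
    (hF : 0 ≤ F) (hf : ∀ k v, |f k v| ≤ F * p v) (hres : ∀ v, p (v - ∑ k, f k v • x k) = 0)
    (T : ℕ) :
    ∃ g : Fin d → ℕ → (Fin d → ℝ) →ₗ[ℝ] ℝ, (∀ k s v, |g k s v| ≤ F * K * p v) ∧
    ∀ (X : ℕ → Ω → (Fin d → ℝ)) (ω : Ω),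
      p (∑ t ∈ Finset.range T, (iterate h α Q₀ y t ω - Qs))
      ≤ K * p (Q₀ ω - Qs)
        + ∑ k, |(1 / (N : ℝ)) * ∑ i, ∑ s ∈ Finset.range T,
            g k s (h i Qs (y i s ω) - ∫ w, h i Qs w ∂(η i))|
        + ∑ k, ∑ l, (1 / (N : ℝ)) * ∑ i, |∑ s ∈ Finset.range T,
            g k s ((A i Qs (y i s ω)).mulVec (x l) - ∫ w, (A i Qs w).mulVec (x l) ∂(η i))
              * f l (X s ω)|
        + K * (C_A + 1) * ∑ s ∈ Finset.range T, p (iterate h α Q₀ y s ω - Qs - X s ω)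
        + K * ∑ s ∈ Finset.range T, p ((1 / (N : ℝ)) • ∑ i,
            (h i (iterate h α Q₀ y s ω) (y i s ω) - h i Qs (y i s ω)
              - (A i Qs (y i s ω)).mulVec (iterate h α Q₀ y s ω - Qs))) := by
  have hN' : (0 : ℝ) < N := by exact_mod_cast S.pos
  have hK : 0 ≤ K := (hU 0).trans hU0
  have hα0 : 0 ≤ α := by linarith [hα.1]
  choose G hG using S.exists_agentMean
  let Gm : (Fin d → ℝ) →ₗ[ℝ] (Fin d → ℝ) := (1 / (N : ℝ)) • ∑ i, G i
  have hGm : ∀ v, Gm v = (1 / (N : ℝ)) • ∑ i, G i v := fun v => by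
    simp [Gm, LinearMap.smul_apply, LinearMap.sum_apply]
  have hGβ : ∀ v, p (Gm v) ≤ β * p v := fun v => by
    rw [hGm]; exact S.seminorm_mean_le hG v
  obtain ⟨L, hL0, hLrec, hLb⟩ := exists_backward_maps p Gm hGβ T (stepsize α) U
    (fun s => (stepsize_pos α s).le) (stepsize_le_one hα0) hU hUrec
  -- The maps $L_s$ are controlled only for $s\le T$; the cutoff gives a bound by $K$ valid at all
  -- times.
  set D : ℕ → (Fin d → ℝ) →ₗ[ℝ] (Fin d → ℝ) := fun s =>
    if s < T then stepsize α s • L (s + 1) else 0 with hDdef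
  have hD : ∀ s v, p (D s v) ≤ K * p v := by
    intro s v
    by_cases hs : s < T
    · simp only [hDdef, if_pos hs, LinearMap.smul_apply]
      rw [map_smul_eq_mul, Real.norm_of_nonneg (stepsize_pos α s).le]
      calc _ ≤ stepsize α s * (U (s + 1) * p v) :=
            mul_le_mul_of_nonneg_left (hLb (s + 1) hs v) (stepsize_pos α s).le
        _ = (stepsize α s * U (s + 1)) * p v := by ring
        _ ≤ K * p v := mul_le_mul_of_nonneg_right (hUK s) (apply_nonneg p v)
    · simp only [hDdef, if_neg hs, LinearMap.zero_apply, map_zero]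
      exact mul_nonneg hK (apply_nonneg p v)
  have hgb : ∀ k s v, |(f k ∘ₗ D s) v| ≤ F * K * p v := fun k s v => by
    rw [mul_assoc]
    exact (hf k _).trans (mul_le_mul_of_nonneg_left (hD s v) hF)
  refine ⟨fun k s => f k ∘ₗ D s, hgb, fun X ω => ?_⟩
  set Δ : ℕ → (Fin d → ℝ) := fun t => iterate h α Q₀ y t ω - Qs with hΔ
  let ξ : ℕ → (Fin d → ℝ) := fun s =>
    (1 / (N : ℝ)) • ∑ i, (h i Qs (y i s ω) - ∫ w, h i Qs w ∂(η i))
  let Bop : ℕ → (Fin d → ℝ) → (Fin d → ℝ) := fun s v =>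
    (1 / (N : ℝ)) • ∑ i, ((A i Qs (y i s ω)).mulVec v - G i v)
  let r : ℕ → (Fin d → ℝ) := fun s => (1 / (N : ℝ)) • ∑ i,
    (h i (iterate h α Q₀ y s ω) (y i s ω) - h i Qs (y i s ω) - (A i Qs (y i s ω)).mulVec (Δ s))
  -- Additive noise, the fixed-point defect in $E$, multiplicative noise and linearization
  -- remainder.
  let n : ℕ → (Fin d → ℝ) := fun s => ξ s + (meanOp h η Qs - Qs) + Bop s (Δ s) + r s
  have hBsub : ∀ s v w, Bop s (v - w) = Bop s v - Bop s w := fun s v w => by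
    simp only [Bop]
    rw [← smul_sub, ← Finset.sum_sub_distrib]
    congr 1
    refine Finset.sum_congr rfl fun i _ => ?_
    rw [Matrix.mulVec_sub, map_sub]; abel
  have hrec : ∀ t, Δ (t + 1) = Δ t - stepsize α t • (Δ t - Gm (Δ t)) + stepsize α t • n t := by
    intro t
    have hn : n t = (1 / (N : ℝ)) • ∑ i, h i (iterate h α Q₀ y t ω) (y i t ω) - Qs - Gm (Δ t) := by
      simp only [n, ξ, Bop, r, meanOp, hGm, Finset.sum_sub_distrib, smul_sub]
      abel
    rw [hn]
    simp only [hΔ, iterate]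
    module
  have hsum := sum_eq_of_backward_maps hL0 hLrec hrec
  have hsum' : ∑ t ∈ Finset.range T, Δ t = L 0 (Δ 0) + ∑ s ∈ Finset.range T, D s (n s) := by
    rw [hsum]
    congr 1
    refine Finset.sum_congr rfl fun s hs => ?_
    simp only [hDdef, if_pos (Finset.mem_range.1 hs)]
  have hsplit : ∑ s ∈ Finset.range T, D s (n s)
      = ∑ s ∈ Finset.range T, D s (ξ s) + ∑ s ∈ Finset.range T, D s (meanOp h η Qs - Qs)
        + ∑ s ∈ Finset.range T, D s (Bop s (X s ω))
        + ∑ s ∈ Finset.range T, D s (Bop s (Δ s - X s ω)) + ∑ s ∈ Finset.range T, D s (r s) := by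
    simp only [← Finset.sum_add_distrib]
    refine Finset.sum_congr rfl fun s _ => ?_
    rw [← map_add, ← map_add, ← map_add, ← map_add]
    congr 1
    simp only [n, hBsub]; abel
  have h0 : p (L 0 (Δ 0)) ≤ K * p (Q₀ ω - Qs) :=
    (hLb 0 (Nat.zero_le T) _).trans (mul_le_mul_of_nonneg_right hU0 (apply_nonneg p _))
  have h1 : p (∑ s ∈ Finset.range T, D s (ξ s)) ≤ ∑ k, |(1 / (N : ℝ)) * ∑ i,
      ∑ s ∈ Finset.range T, (f k ∘ₗ D s) (h i Qs (y i s ω) - ∫ w, h i Qs w ∂(η i))| := by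
    refine (seminorm_le_sum_coordinates hx hres _).trans (le_of_eq ?_)
    refine Finset.sum_congr rfl fun k _ => ?_
    rw [map_sum, Finset.sum_comm, Finset.mul_sum]
    congr 1
    refine Finset.sum_congr rfl fun s _ => ?_
    simp only [ξ, map_smul, map_sum, LinearMap.comp_apply, smul_eq_mul]
  have h2 : p (∑ s ∈ Finset.range T, D s (meanOp h η Qs - Qs)) ≤ 0 := by
    refine (seminorm_sum_le p _ _).trans (Finset.sum_nonpos fun s _ => ?_)
    refine (hD s _).trans ?_
    rw [S.fixed, mul_zero]
  have hBb : ∀ s v, p (Bop s v) ≤ (C_A + 1) * p v := fun s v => by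
    have e : Bop s v = (1 / (N : ℝ)) • ∑ i, (A i Qs (y i s ω)).mulVec v - Gm v := by
      simp only [Bop, hGm, Finset.sum_sub_distrib, smul_sub]
    rw [e]
    refine (map_sub_le_add p _ _).trans ?_
    have h3 := seminorm_average_le (p := p) S.pos fun i => S.bound_A i Qs (y i s ω) v
    have h4 := mul_le_mul_of_nonneg_right S.contr_lt_one.le (apply_nonneg p v)
    linarith [hGβ v]
  have h3 : p (∑ s ∈ Finset.range T, D s (Bop s (X s ω))) ≤ ∑ k, ∑ l, (1 / (N : ℝ)) * ∑ i,
      |∑ s ∈ Finset.range T, (f k ∘ₗ D s) ((A i Qs (y i s ω)).mulVec (x l)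
        - ∫ w, (A i Qs w).mulVec (x l) ∂(η i)) * f l (X s ω)| := by
    refine (seminorm_le_sum_coordinates hx hres _).trans (Finset.sum_le_sum fun k _ => ?_)
    have hlin : ∀ s i, (A i Qs (y i s ω)).mulVec (∑ l, f l (X s ω) • x l)
          - G i (∑ l, f l (X s ω) • x l)
        = ∑ l, f l (X s ω) • ((A i Qs (y i s ω)).mulVec (x l)
          - ∫ w, (A i Qs w).mulVec (x l) ∂(η i)) := fun s i => by
      rw [← Matrix.mulVecLin_apply, map_sum, map_sum, ← Finset.sum_sub_distrib]
      refine Finset.sum_congr rfl fun l _ => ?_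
      rw [map_smul, map_smul, ← smul_sub, hG, Matrix.mulVecLin_apply]
    have hterm : ∀ s, f k (D s (Bop s (X s ω))) = ∑ l, (1 / (N : ℝ)) * ∑ i,
        (f k ∘ₗ D s) ((A i Qs (y i s ω)).mulVec (x l)
          - ∫ w, (A i Qs w).mulVec (x l) ∂(η i)) * f l (X s ω) := fun s => by
      -- Expanding $X_s$ in the adapted vectors leaves an error in the kernel of $p$. The
      -- multiplicative noise keeps it in that kernel, where the functionals vanish, so random
      -- weights separate from deterministic vectors.
      have hz : p (Bop s (X s ω) - Bop s (∑ l, f l (X s ω) • x l)) = 0 := by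
        rw [← hBsub]
        refine le_antisymm ((hBb s _).trans ?_) (apply_nonneg p _)
        rw [hres, mul_zero]
      have := linearMap_sub_eq_of_seminorm_eq_zero (hgb k s) hz
      rw [← LinearMap.comp_apply, this]
      simp only [Bop, hlin]
      rw [map_smul, map_sum, smul_eq_mul, ← Finset.mul_sum, Finset.sum_comm]
      congr 1
      refine Finset.sum_congr rfl fun i _ => ?_
      rw [map_sum]
      refine Finset.sum_congr rfl fun l _ => ?_
      rw [map_smul, smul_eq_mul, mul_comm]
    rw [map_sum]
    simp only [hterm]
    rw [Finset.sum_comm]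
    refine (Finset.abs_sum_le_sum_abs _ _).trans (Finset.sum_le_sum fun l _ => ?_)
    rw [← Finset.mul_sum, Finset.sum_comm, abs_mul, abs_of_nonneg (by positivity)]
    gcongr
    exact Finset.abs_sum_le_sum_abs _ _
  have h4 : p (∑ s ∈ Finset.range T, D s (Bop s (Δ s - X s ω)))
      ≤ K * (C_A + 1) * ∑ s ∈ Finset.range T, p (Δ s - X s ω) := by
    refine (seminorm_sum_le p _ _).trans ?_
    rw [Finset.mul_sum]
    refine Finset.sum_le_sum fun s _ => (hD s _).trans ?_
    rw [mul_assoc]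
    exact mul_le_mul_of_nonneg_left (hBb s _) hK
  have h5 : p (∑ s ∈ Finset.range T, D s (r s)) ≤ K * ∑ s ∈ Finset.range T, p (r s) := by
    refine (seminorm_sum_le p _ _).trans ?_
    rw [Finset.mul_sum]
    exact Finset.sum_le_sum fun s _ => hD s _
  have htri : p (∑ t ∈ Finset.range T, Δ t) ≤ p (L 0 (Δ 0))
      + (p (∑ s ∈ Finset.range T, D s (ξ s)) + p (∑ s ∈ Finset.range T, D s (meanOp h η Qs - Qs))
        + p (∑ s ∈ Finset.range T, D s (Bop s (X s ω)))
        + p (∑ s ∈ Finset.range T, D s (Bop s (Δ s - X s ω)))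
        + p (∑ s ∈ Finset.range T, D s (r s))) := by
    rw [hsum', hsplit]
    refine (map_add_le_add p _ _).trans (add_le_add le_rfl ?_)
    refine (map_add_le_add p _ _).trans (add_le_add ?_ le_rfl)
    refine (map_add_le_add p _ _).trans (add_le_add ?_ le_rfl)
    refine (map_add_le_add p _ _).trans (add_le_add ?_ le_rfl)
    exact map_add_le_add p _ _
  linarith

end Decomposition

/-! ### Collecting the terms and dividing by $T$. -/

/-- Mean of the summed deviations, in terms of the mixing time and the sum of the stepsizes. -/
lemma integral_sum_deviation_le [IsProbabilityMeasure μ]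
    (S : PiecewiseLinearSA μ p h b A η y Q₀ Qs β C_A C_b C_s C_E ρ R) {α : ℝ}
    (hα : α ∈ Set.Ioo (1 / 2 : ℝ) 1) (hρ : ρ ∈ Set.Ioo (0 : ℝ) 1)
    {U : ℕ → ℝ} {K : ℝ} (hU : ∀ s, 0 ≤ U s) (hU0 : U 0 ≤ K)
    (hUK : ∀ s, stepsize α s * U (s + 1) ≤ K)
    (hUrec : ∀ s, 1 + (1 - (1 - β) * stepsize α s) * U (s + 1) ≤ U s)
    (h0 : Integrable (fun ω => p (Q₀ ω - Qs)) μ) {B C_Q : ℝ} (hCQ : 0 ≤ C_Q)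
    (hB : ∀ t, ∫ ω, (1 + p (iterate h α Q₀ y t ω - Qs)) ∂μ ≤ B)
    (hrate : RawIterateRate μ p (iterate h α Q₀ y) Qs ρ α C_Q) (T : ℕ) :
    Integrable (fun ω => p (∑ t ∈ Finset.range T, (iterate h α Q₀ y t ω - Qs))) μ ∧
    ∫ ω, p (∑ t ∈ Finset.range T, (iterate h α Q₀ y t ω - Qs)) ∂μ
      ≤ K * B
        + d * (√((2 * (2 ^ d * K * (C_b + C_A * R))) ^ 2 * (2 * mixTime ρ α T + 1
              + 2 * (C_E * ρ ^ mixTime ρ α T) * T) * T / N)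
            + 2 * (2 ^ d * K * (C_b + C_A * R)) * (mixTime ρ α T + 1
              + 2 * (C_E * ρ ^ mixTime ρ α T) * T))
        + d * (d * √((2 * (2 ^ d * K * C_A)) ^ 2 * (2 * mixTime ρ α T + 1
              + 2 * (C_E * ρ ^ mixTime ρ α T) * T)
            * ((2 ^ d) ^ 2 * (C_Q * mixTime ρ α T * ∑ s ∈ Finset.range T, stepsize α s))))
        + K * (C_A + 1) * (B * (burnIn ρ α + mixTime ρ α T + 1)
            + (C_b + (C_A + 1) * (R + 1)) * B * mixTime ρ α T
              * ∑ s ∈ Finset.range T, stepsize α s)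
        + K * (2 * (C_b + (C_A + 1) * (R + 1)) * B * (burnIn ρ α + 1)
            + 2 * ((C_b + C_A * R) / C_s ^ 2 + C_A / C_s) * C_Q * mixTime ρ α T
              * ∑ s ∈ Finset.range T, stepsize α s) := by
  have hα0 : 0 ≤ α := by linarith [hα.1]
  have hK : 0 ≤ K := (hU 0).trans hU0
  have hN' : (0 : ℝ) < N := by exact_mod_cast S.pos
  have hA := S.C_A_pos
  have hE := S.C_E_pos
  have hρ0 := S.rate_pos
  obtain ⟨f, x, hx, hf, hres⟩ := exists_seminorm_coordinates d p (by simp)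
  obtain ⟨g, hg, hpath⟩ := S.seminorm_sum_deviation_le hα hU hU0 hUK hUrec hx (by positivity) hf
    hres T
  obtain ⟨X, hXm, hX2, hX2s, hXd, hXds⟩ := S.exists_lagged_deviation hα0 hρ h0 hCQ hB hrate T
  obtain ⟨r, hr, hri, hrs⟩ := S.integral_remainder_le hα0 hρ h0 hCQ hB hrate T
  set τ := mixTime ρ α T
  have hFK : (0 : ℝ) ≤ 2 ^ d * K := by positivity
  have hnoise := fun k => S.integral_abs_noise_le hFK (hg k) τ T
  have hmult := fun k l i => S.integral_abs_multiplicative_noise_le hFK (hg k) (hx l) (hf l) hXm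
    hX2 i T
  set Φ₀ : Ω → ℝ := fun ω => K * p (Q₀ ω - Qs)
  set Φ₁ : Ω → ℝ := fun ω => ∑ k, |(1 / (N : ℝ)) * ∑ i, ∑ s ∈ Finset.range T,
    g k s (h i Qs (y i s ω) - ∫ w, h i Qs w ∂(η i))|
  set Φ₂ : Ω → ℝ := fun ω => ∑ k, ∑ l, (1 / (N : ℝ)) * ∑ i, |∑ s ∈ Finset.range T,
    g k s ((A i Qs (y i s ω)).mulVec (x l) - ∫ w, (A i Qs w).mulVec (x l) ∂(η i)) * f l (X s ω)|
  set Φ₃ : Ω → ℝ := fun ω =>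
    K * (C_A + 1) * ∑ s ∈ Finset.range T, p (iterate h α Q₀ y s ω - Qs - X s ω)
  set Φ₄ : Ω → ℝ := fun ω => K * ∑ s ∈ Finset.range T, r s ω
  have i0 : Integrable Φ₀ μ := h0.const_mul K
  have i1 : Integrable Φ₁ μ := integrable_finsetSum _ fun k _ => (hnoise k).1.abs
  have i2' : ∀ k l, Integrable (fun ω => (1 / (N : ℝ)) * ∑ i, |∑ s ∈ Finset.range T,
      g k s ((A i Qs (y i s ω)).mulVec (x l) - ∫ w, (A i Qs w).mulVec (x l) ∂(η i))
        * f l (X s ω)|) μ := fun k l =>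
    (integrable_finsetSum _ fun i _ => (hmult k l i).1).const_mul _
  have i2 : Integrable Φ₂ μ := integrable_finsetSum _ fun k _ => integrable_finsetSum _ fun l _ =>
    i2' k l
  have i3 : Integrable Φ₃ μ := (integrable_finsetSum _ fun s _ => hXd s).const_mul _
  have i4 : Integrable Φ₄ μ := (integrable_finsetSum _ fun s _ => hri s).const_mul _
  have hle : ∀ ω, p (∑ t ∈ Finset.range T, (iterate h α Q₀ y t ω - Qs))
      ≤ Φ₀ ω + Φ₁ ω + Φ₂ ω + Φ₃ ω + Φ₄ ω := fun ω => by
    refine (hpath X ω).trans (add_le_add le_rfl ?_)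
    exact mul_le_mul_of_nonneg_left (Finset.sum_le_sum fun s _ => hr s ω) hK
  have i01 : Integrable (fun ω => Φ₀ ω + Φ₁ ω) μ := i0.add i1
  have i02 : Integrable (fun ω => Φ₀ ω + Φ₁ ω + Φ₂ ω) μ := i01.add i2
  have i03 : Integrable (fun ω => Φ₀ ω + Φ₁ ω + Φ₂ ω + Φ₃ ω) μ := i02.add i3
  have iall : Integrable (fun ω => Φ₀ ω + Φ₁ ω + Φ₂ ω + Φ₃ ω + Φ₄ ω) μ := i03.add i4
  have hmeas : Measurable fun ω => p (∑ t ∈ Finset.range T, (iterate h α Q₀ y t ω - Qs)) :=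
    (seminorm_continuous p).measurable.comp
      (Finset.measurable_sum _ fun t _ => (S.meas_iterate α t).sub_const Qs)
  have hint : Integrable (fun ω => p (∑ t ∈ Finset.range T, (iterate h α Q₀ y t ω - Qs))) μ :=
    Integrable.mono' iall hmeas.aestronglyMeasurable (Filter.Eventually.of_forall fun ω => by
      rw [Real.norm_of_nonneg (apply_nonneg p _)]; exact hle ω)
  refine ⟨hint, (integral_mono hint iall hle).trans ?_⟩
  rw [integral_add i03 i4, integral_add i02 i3, integral_add i01 i2, integral_add i0 i1]
  refine add_le_add (add_le_add (add_le_add (add_le_add ?_ ?_) ?_) ?_) ?_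
  · rw [integral_const_mul]
    have h1 := hB 0
    rw [integral_add (integrable_const 1) (S.integrable_dist hα0 h0 0), integral_const,
      probReal_univ, one_smul] at h1
    refine mul_le_mul_of_nonneg_left ?_ hK
    simp only [iterate] at h1
    linarith
  · rw [integral_finsetSum _ fun k _ => (hnoise k).1.abs]
    refine (Finset.sum_le_sum fun k _ => (hnoise k).2).trans ?_
    rw [Finset.sum_const, Finset.card_univ, Fintype.card_fin, nsmul_eq_mul]
  · rw [integral_finsetSum _ fun k _ => integrable_finsetSum _ fun l _ => i2' k l]
    refine (Finset.sum_le_card_nsmul Finset.univ _ _ fun k _ => ?_).trans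
      (by rw [Finset.card_univ, Fintype.card_fin, nsmul_eq_mul])
    rw [integral_finsetSum _ fun l _ => i2' k l]
    refine (Finset.sum_le_card_nsmul Finset.univ _ _ fun l _ => ?_).trans
      (by rw [Finset.card_univ, Fintype.card_fin, nsmul_eq_mul])
    -- The weights $X_s$ couple all agents, so the agents are combined by the triangle inequality
    -- with no gain in $N$; the term is of higher order already.
    rw [integral_const_mul, integral_finsetSum _ fun i _ => (hmult k l i).1, one_div,
      inv_mul_le_iff₀ hN']
    refine (Finset.sum_le_card_nsmul Finset.univ _ _ fun i _ => ?_).trans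
      (by rw [Finset.card_univ, Fintype.card_fin, nsmul_eq_mul])
    refine (hmult k l i).2.trans (Real.sqrt_le_sqrt ?_)
    gcongr
  · rw [integral_const_mul, integral_finsetSum _ fun s _ => hXd s]
    exact mul_le_mul_of_nonneg_left hXds (by positivity)
  · rw [integral_const_mul, integral_finsetSum _ fun s _ => hri s]
    exact mul_le_mul_of_nonneg_left hrs hK

/-- Collecting the error terms: all but the variance term are of order `τ S'`. -/
lemma error_terms_le {K B C_A C_E C_Q M M' c κ t₀ τ e T N Sa S' F n : ℝ} (hK : 0 ≤ K) (hB0 : 0 ≤ B)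
    (hA : 0 ≤ C_A) (hE : 0 ≤ C_E) (hCQ : 0 ≤ C_Q) (hM0 : 0 ≤ M) (hM0' : 0 ≤ M') (hc : 0 ≤ c)
    (hκ0 : 0 ≤ κ) (ht₀ : 0 ≤ t₀) (hτ1 : 1 ≤ τ) (he0 : 0 ≤ e) (he : e ≤ 2 * C_E) (hT' : 0 ≤ T)
    (hN' : 0 < N) (hSa0 : 0 ≤ Sa)
    (hSa : Sa ≤ S') (hS1 : 1 ≤ S') (hF : 0 ≤ F) (hn : 0 ≤ n) :
    K * B + n * (√(M ^ 2 * (2 * τ + 1 + e) * T / N) + M * (τ + 1 + e))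
        + n * (n * √(M' ^ 2 * (2 * τ + 1 + e) * (F ^ 2 * (C_Q * τ * Sa))))
        + K * (C_A + 1) * (B * (t₀ + τ + 1) + c * B * τ * Sa)
        + K * (2 * c * B * (t₀ + 1) + κ * C_Q * τ * Sa)
      ≤ n * (M * √(3 + 2 * C_E) * √τ * (√T / √N))
        + (K * B + n * (M * (2 + 2 * C_E)) + n * (n * (M' * √(3 + 2 * C_E) * F * √C_Q))
          + K * (C_A + 1) * (B * (t₀ + 2) + c * B) + K * (2 * c * B * (t₀ + 1) + κ * C_Q))
          * (τ * S') := by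
  set q := √(3 + 2 * C_E) with hq
  have hEτ : 2 * C_E ≤ 2 * C_E * τ := le_mul_of_one_le_right (by positivity) hτ1
  have hv : 2 * τ + 1 + e ≤ (3 + 2 * C_E) * τ := by linarith
  have hm : τ + 1 + e ≤ (2 + 2 * C_E) * τ := by linarith
  have hτS : τ ≤ τ * S' := le_mul_of_one_le_right (by linarith) hS1
  have h1S : 1 ≤ τ * S' := hτ1.trans hτS
  have hsq1 : √(M ^ 2 * (2 * τ + 1 + e) * T / N) ≤ M * q * √τ * (√T / √N) := by
    calc _ ≤ √(M ^ 2 * (((3 + 2 * C_E) * τ) * (T / N))) := by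
          refine Real.sqrt_le_sqrt ?_
          rw [mul_assoc, mul_div_assoc, mul_div_assoc]
          gcongr
      _ = _ := by
          rw [Real.sqrt_mul (sq_nonneg M), Real.sqrt_sq hM0, Real.sqrt_mul (by positivity),
            Real.sqrt_mul (by positivity), Real.sqrt_div hT']
          ring
  -- One factor $\tau$ comes from the correlation length and one from (A4), so the root carries
  -- $\tau\sqrt{S'}$, and $\sqrt{S'}\le S'$ because $S'\ge1$.
  have hsq2 : √(M' ^ 2 * (2 * τ + 1 + e) * ((F) ^ 2 * (C_Q * τ * Sa)))
      ≤ M' * q * F * √C_Q * (τ * S') := by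
    have hq2 : q ^ 2 = 3 + 2 * C_E := Real.sq_sqrt (by positivity)
    have hC2 : √C_Q ^ 2 = C_Q := Real.sq_sqrt hCQ
    refine Real.sqrt_le_iff.2 ⟨by positivity, ?_⟩
    calc _ ≤ M' ^ 2 * ((3 + 2 * C_E) * τ) * ((F) ^ 2 * (C_Q * τ * S')) := by
          have : 0 ≤ 2 * τ + 1 + e := by
            linarith
          gcongr
      _ = M' ^ 2 * (3 + 2 * C_E) * (F) ^ 2 * C_Q * τ ^ 2 * S' := by ring
      _ ≤ M' ^ 2 * (3 + 2 * C_E) * (F) ^ 2 * C_Q * τ ^ 2 * (S' * S') := by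
          gcongr
          exact le_mul_of_one_le_left (by linarith) hS1
      _ = _ := by rw [← hq2]; nth_rewrite 1 [← hC2]; ring
  have hSaτ : τ * Sa ≤ τ * S' := mul_le_mul_of_nonneg_left hSa (by linarith)
  have a0 : K * B ≤ K * B * (τ * S') := le_mul_of_one_le_right (by positivity) h1S
  have a1 : n * (√(M ^ 2 * (2 * τ + 1 + e) * T / N) + M * (τ + 1 + e))
      ≤ n * (M * q * √τ * (√T / √N)) + n * (M * (2 + 2 * C_E)) * (τ * S') := by
    have : M * (τ + 1 + e) ≤ M * ((2 + 2 * C_E) * (τ * S')) := by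
      gcongr; exact hm.trans (by gcongr)
    calc _ ≤ n * (M * q * √τ * (√T / √N) + M * ((2 + 2 * C_E) * (τ * S'))) := by gcongr
      _ = _ := by ring
  have a2 : n * (n * √(M' ^ 2 * (2 * τ + 1 + e) * ((F) ^ 2 * (C_Q * τ * Sa))))
      ≤ n * (n * (M' * q * F * √C_Q)) * (τ * S') := by
    calc _ ≤ n * (n * (M' * q * F * √C_Q * (τ * S'))) := by gcongr
      _ = _ := by ring
  have a3 : K * (C_A + 1) * (B * (t₀ + τ + 1) + c * B * τ * Sa)
      ≤ K * (C_A + 1) * (B * (t₀ + 2) + c * B) * (τ * S') := by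
    rw [mul_assoc (K * (C_A + 1)), mul_assoc (c * B)]
    gcongr
    have h3 : t₀ + τ + 1 ≤ (t₀ + 2) * (τ * S') := by nlinarith
    calc _ ≤ B * ((t₀ + 2) * (τ * S')) + c * B * (τ * S') := by gcongr
      _ = _ := by ring
  have a4 : K * (2 * c * B * (t₀ + 1) + κ * C_Q * τ * Sa)
      ≤ K * (2 * c * B * (t₀ + 1) + κ * C_Q) * (τ * S') := by
    have h4 : 2 * c * B * (t₀ + 1) ≤ 2 * c * B * (t₀ + 1) * (τ * S') :=
      le_mul_of_one_le_right (by positivity) h1S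
    have h5 : κ * C_Q * (τ * Sa) ≤ κ * C_Q * (τ * S') := by gcongr
    calc _ = K * (2 * c * B * (t₀ + 1) + κ * C_Q * (τ * Sa)) := by ring
      _ ≤ K * (2 * c * B * (t₀ + 1) * (τ * S') + κ * C_Q * (τ * S')) := by gcongr
      _ = _ := by ring
  linarith

/-- The averaged iterate: mean distance to the fixed point, with the variance term reduced by the
number of agents and a higher order term. -/
lemma integral_average_le [IsProbabilityMeasure μ]
    (S : PiecewiseLinearSA μ p h b A η y Q₀ Qs β C_A C_b C_s C_E ρ R) {α : ℝ}
    (hα : α ∈ Set.Ioo (1 / 2 : ℝ) 1) (hρ : ρ ∈ Set.Ioo (0 : ℝ) 1)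
    {U : ℕ → ℝ} {K : ℝ} (hU : ∀ s, 0 ≤ U s) (hU0 : U 0 ≤ K)
    (hUK : ∀ s, stepsize α s * U (s + 1) ≤ K)
    (hUrec : ∀ s, 1 + (1 - (1 - β) * stepsize α s) * U (s + 1) ≤ U s)
    (h0 : Integrable (fun ω => p (Q₀ ω - Qs)) μ) {B C_Q C_L : ℝ} (hCQ : 0 ≤ C_Q)
    (hB : ∀ t, ∫ ω, (1 + p (iterate h α Q₀ y t ω - Qs)) ∂μ ≤ B)
    (hrate : RawIterateRate μ p (iterate h α Q₀ y) Qs ρ α C_Q) {T : ℕ} (hT : 0 < T)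
    (hL : (mixTime ρ α T : ℝ) ≤ C_L * Real.log T) :
    Integrable (fun ω => p (runningAverage (iterate h α Q₀ y) T ω - Qs)) μ ∧
    ∫ ω, p (runningAverage (iterate h α Q₀ y) T ω - Qs) ∂μ
      ≤ (d * (2 * (2 ^ d * K * (C_b + C_A * R))) * √(3 + 2 * C_E)) * √(mixTime ρ α T : ℝ)
          / √((N : ℝ) * (T : ℝ))
        + (K * B + d * (2 * (2 ^ d * K * (C_b + C_A * R)) * (2 + 2 * C_E))
            + d * (d * (2 * (2 ^ d * K * C_A) * √(3 + 2 * C_E) * 2 ^ d * √C_Q))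
            + K * (C_A + 1) * (B * (burnIn ρ α + 2) + (C_b + (C_A + 1) * (R + 1)) * B)
            + K * (2 * (C_b + (C_A + 1) * (R + 1)) * B * (burnIn ρ α + 1)
              + 2 * ((C_b + C_A * R) / C_s ^ 2 + C_A / C_s) * C_Q)) / (1 - α) * C_L
          * Real.log T / (T : ℝ) ^ α := by
  obtain ⟨hint, hle⟩ := S.integral_sum_deviation_le hα hρ hU hU0 hUK hUrec h0 hCQ hB hrate T
  have hK : 0 ≤ K := (hU 0).trans hU0
  have hR : 0 ≤ R := (apply_nonneg p Qs).trans S.fixed_le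
  have hN' : (0 : ℝ) < N := by exact_mod_cast S.pos
  have hT' : (0 : ℝ) < T := by exact_mod_cast hT
  have hA := S.C_A_pos
  have hb := S.C_b_pos
  have hs := S.C_s_pos
  have hE := S.C_E_pos
  have hc := S.drift_const_pos
  have hα1 : 0 < 1 - α := by linarith [hα.2]
  have hB0 : 0 ≤ B := (integral_nonneg fun ω => by
    have := apply_nonneg p (iterate h α Q₀ y 0 ω - Qs)
    change 0 ≤ 1 + p _; linarith).trans (hB 0)
  have havg : ∀ ω, p (runningAverage (iterate h α Q₀ y) T ω - Qs)
      = (T : ℝ)⁻¹ * p (∑ t ∈ Finset.range T, (iterate h α Q₀ y t ω - Qs)) := fun ω => by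
    have e : ∑ t ∈ Finset.range T, (iterate h α Q₀ y t ω - Qs)
        = (T : ℝ) • (runningAverage (iterate h α Q₀ y) T ω - Qs) := by
      rw [smul_sub, smul_runningAverage, Finset.sum_sub_distrib, Finset.sum_const,
        Finset.card_range, Nat.cast_smul_eq_nsmul]
    rw [e, map_smul_eq_mul, Real.norm_of_nonneg hT'.le, inv_mul_cancel_left₀ hT'.ne']
  simp only [havg]
  refine ⟨hint.const_mul _, ?_⟩
  rw [integral_const_mul]
  have hτ1 := one_le_mixTime (α := α) hρ T
  set c := C_b + (C_A + 1) * (R + 1)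
  set M := 2 * (2 ^ d * K * (C_b + C_A * R)) with hM
  set M' := 2 * (2 ^ d * K * C_A) with hM'
  set κ := 2 * ((C_b + C_A * R) / C_s ^ 2 + C_A / C_s) with hκ
  set q := √(3 + 2 * C_E) with hq
  have hM0 : 0 ≤ M := by positivity
  have hM0' : 0 ≤ M' := by positivity
  have hκ0 : 0 ≤ κ := by positivity
  -- $T\rho^{\tau_T}\le T\alpha_T^2\le1$: the accumulated mixing error stays bounded.
  have hmix : 2 * (C_E * ρ ^ mixTime ρ α T) * T ≤ 2 * C_E := by
    have h1 : ρ ^ mixTime ρ α T * T ≤ 1 := by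
      have h2 := mul_le_mul_of_nonneg_right (mixTime_spec (α := α) hρ T).2 hT'.le
      have h3 := mul_stepsize_sq_le_one hα.1.le T
      linarith
    nlinarith
  have he0 : 0 ≤ 2 * (C_E * ρ ^ mixTime ρ α T) * T := by
    have := hρ.1
    positivity
  set e := 2 * (C_E * ρ ^ mixTime ρ α T) * T
  set τ := (mixTime ρ α T : ℝ)
  set Sa := ∑ s ∈ Finset.range T, stepsize α s
  set S' := (T : ℝ) ^ (1 - α) / (1 - α) with hS'
  have hSa : Sa ≤ S' := sum_stepsize_le hα T
  have hS1 : 1 ≤ S' := by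
    rw [hS', le_div_iff₀ hα1, one_mul]
    have : (1 : ℝ) ≤ (T : ℝ) ^ (1 - α) := Real.one_le_rpow (by exact_mod_cast hT) hα1.le
    linarith [hα.1]
  set t₀ := (burnIn ρ α : ℝ)
  have ht₀ : 0 ≤ t₀ := Nat.cast_nonneg _
  set C' := K * B + d * (M * (2 + 2 * C_E)) + d * (d * (M' * q * 2 ^ d * √C_Q))
    + K * (C_A + 1) * (B * (t₀ + 2) + c * B) + K * (2 * c * B * (t₀ + 1) + κ * C_Q) with hC'
  have hC0 : 0 ≤ C' := by positivity
  have htot : ∫ ω, p (∑ t ∈ Finset.range T, (iterate h α Q₀ y t ω - Qs)) ∂μ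
      ≤ d * (M * q * √τ * (√T / √N)) + C' * (τ * S') := by
    exact hle.trans (error_terms_le hK hB0 hA.le hE.le hCQ hM0 hM0' hc.le hκ0 ht₀ hτ1
      he0 hmix hT'.le hN'
      (Finset.sum_nonneg fun s _ => (stepsize_pos α s).le) hSa hS1 (by positivity) (Nat.cast_nonneg d))
  calc _ ≤ (T : ℝ)⁻¹ * (d * (M * q * √τ * (√T / √N)) + C' * ((C_L * Real.log T) * S')) := by
        refine mul_le_mul_of_nonneg_left (htot.trans ?_) (by positivity)
        gcongr
    _ = _ := by
        rw [mul_add]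
        congr 1
        · rw [Real.sqrt_mul hN'.le]
          have h1 : √(T : ℝ) ≠ 0 := (Real.sqrt_pos.2 hT').ne'
          have h2 : √(N : ℝ) ≠ 0 := (Real.sqrt_pos.2 hN').ne'
          have h3 : (T : ℝ)⁻¹ = (√(T : ℝ))⁻¹ * (√(T : ℝ))⁻¹ := by
            rw [← mul_inv, Real.mul_self_sqrt hT'.le]
          rw [h3]
          field_simp
        · rw [hS', Real.rpow_sub hT', Real.rpow_one]
          field_simp

end PiecewiseLinearSA

end FixedPointSA

/-! ### Main theorem: the order in which the constants are chosen. -/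

theorem theorem1 (d : ℕ) (α ρ β C_E C_A C_b R : ℝ)
    (hα : α ∈ Set.Ioo (1 / 2 : ℝ) 1) (hρ : ρ ∈ Set.Ioo (0 : ℝ) 1) (hβ : β ∈ Set.Ico (0 : ℝ) 1)
    (hCE : 0 < C_E) (hCA : 0 < C_A) (hCb : 0 < C_b) :
    ((fun T : ℕ => (FixedPointSA.mixTime ρ α T : ℝ)) =O[Filter.atTop]
      fun T : ℕ => Real.log (T : ℝ)) ∧
    ∃ C₁ : ℝ, ∀ C_s C_Q R₀ : ℝ, 0 < C_s → 0 < C_Q → ∃ C₂ : ℝ,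
      ∀ (N : ℕ) (Ω Y : Type*) [MeasurableSpace Ω] [MeasurableSpace Y]
        (μ : Measure Ω) [IsProbabilityMeasure μ]
        (p : Seminorm ℝ (Fin d → ℝ))
        (h : Fin N → (Fin d → ℝ) → Y → (Fin d → ℝ))
        (κ : Fin N → Kernel Y Y) [∀ i, IsMarkovKernel (κ i)] (η : Fin N → Measure Y)
        (y : Fin N → ℕ → Ω → Y) (Q₀ : Ω → (Fin d → ℝ)) (Qs : Fin d → ℝ),
        0 < N →
        -- independent Markov chains with unique stationary distributions
        (∀ i, FixedPointSA.IsMarkovChain μ (y i) (κ i)) →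
        (∀ i, FixedPointSA.IsUniqueStationary (κ i) (η i)) →
        iIndepFun (fun i ω t => y i t ω) μ →
        -- the mean operator is a well-defined seminorm contraction with fixed point `Qs`
        (∀ i Q, Integrable (h i Q) (η i)) →
        (∀ Q Q', p (FixedPointSA.meanOp h η Q - FixedPointSA.meanOp h η Q') ≤ β * p (Q - Q')) →
        FixedPointSA.IsSeminormFixedPoint p (FixedPointSA.meanOp h η) Qs →
        p Qs ≤ R →
        -- the random initial point
        Measurable Q₀ →
        Integrable (fun ω => p (Q₀ ω - Qs)) μ →
        ∫ ω, p (Q₀ ω - Qs) ∂μ ≤ R₀ →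
        -- the four assumptions
        FixedPointSA.PiecewiseLinear p h η C_A C_b C_s →
        FixedPointSA.GeometricMixing μ Q₀ y η C_E ρ →
        FixedPointSA.HasMonotoneInducedNorm p →
        FixedPointSA.RawIterateRate μ p (FixedPointSA.iterate h α Q₀ y) Qs ρ α C_Q →
        ∀ T : ℕ, FixedPointSA.burnIn ρ α < T →
          Integrable (fun ω =>
            p (FixedPointSA.runningAverage (FixedPointSA.iterate h α Q₀ y) T ω - Qs)) μ ∧
          ∫ ω, p (FixedPointSA.runningAverage (FixedPointSA.iterate h α Q₀ y) T ω - Qs) ∂μ ≤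
            C₁ * √(FixedPointSA.mixTime ρ α T : ℝ) / √((N : ℝ) * (T : ℝ))
              + C₂ * Real.log (T : ℝ) / (T : ℝ) ^ α := by
  have hα0 : 0 < α := by linarith [hα.1]
  obtain ⟨C_L, hCL, hlog⟩ := FixedPointSA.exists_mixTime_le_log hρ hα0.le
  refine ⟨Asymptotics.IsBigO.of_bound C_L ?_, ?_⟩
  · filter_upwards [Filter.eventually_ge_atTop 2] with T hT
    have h1 : 0 ≤ Real.log T := Real.log_natCast_nonneg T
    rw [Real.norm_of_nonneg (Nat.cast_nonneg _), Real.norm_of_nonneg h1]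
    exact hlog T hT
  -- `K` depends on $\alpha$ and $\beta$ only and is fixed before the problem instance; the first
  -- constant needs nothing about $C_*$, $C_Q$ or the initial point.
  obtain ⟨U, K, -, hU, hU0, hUK, hUrec⟩ :=
    FixedPointSA.exists_backward_weight hα (c := 1 - β) (by linarith [hβ.2])
  obtain ⟨D, -, hD⟩ := FixedPointSA.exists_mixTime_mul_stepsize_le hρ hα0
  refine ⟨d * (2 * (2 ^ d * K * (C_b + C_A * R))) * √(3 + 2 * C_E), ?_⟩
  intro C_s C_Q R₀ hCs hCQ
  -- `B` bounds $\mathbb{E}(1+p(Q_t-Q^*))$ uniformly in $t$. It carries the dependence on the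
  -- initial point, which therefore enters the second constant only.
  obtain ⟨B, hBdef⟩ : ∃ B : ℝ, B = (1 + (C_b + (C_A + 1) * (R + 1))) ^ FixedPointSA.burnIn ρ α
    * (1 + R₀) + (2 + C_Q * D) := ⟨_, rfl⟩
  refine ⟨(K * B + d * (2 * (2 ^ d * K * (C_b + C_A * R)) * (2 + 2 * C_E))
            + d * (d * (2 * (2 ^ d * K * C_A) * √(3 + 2 * C_E) * 2 ^ d * √C_Q))
            + K * (C_A + 1) * (B * (FixedPointSA.burnIn ρ α + 2) + (C_b + (C_A + 1) * (R + 1)) * B)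
            + K * (2 * (C_b + (C_A + 1) * (R + 1)) * B * (FixedPointSA.burnIn ρ α + 1)
              + 2 * ((C_b + C_A * R) / C_s ^ 2 + C_A / C_s) * C_Q)) / (1 - α) * C_L, ?_⟩
  intro N Ω Y _ _ μ _ p h κ _ η y Q₀ Qs hN hMarkov hstat hind hint hcontr hfix hR hQ₀ hQ₀i hR₀
    hpl hmix _ hrate T hT
  choose b A hb hA heq _ _ hbd hloc using hpl
  have S : FixedPointSA.PiecewiseLinearSA μ p h b A η y Q₀ Qs β C_A C_b C_s C_E ρ R :=
    { pos := hN
      indep := hind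
      meas_obs := fun i => (hMarkov i).1
      meas_init := hQ₀
      prob := fun i => (hstat i).1
      integrable := hint
      contraction := hcontr
      fixed := hfix
      fixed_le := hR
      meas_b := hb
      meas_A := hA
      eq := heq
      bound_A := fun i Q z => (hbd i Q z).1
      bound_b := fun i Q z => (hbd i Q z).2
      loc := fun i => hloc i Qs hfix
      mixing := hmix
      C_A_pos := hCA
      C_b_pos := hCb
      C_s_pos := hCs
      C_E_pos := hCE
      contr_lt_one := hβ.2
      rate_pos := hρ.1 }
  have hB := fun t => (S.integral_dist_le hα0.le hQ₀i hR₀ hCQ.le hD hrate t).trans_eq hBdef.symm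
  have hT2 : 2 ≤ T := by
    have := FixedPointSA.one_le_burnIn hρ hα0.le
    omega
  exact S.integral_average_le hα hρ hU hU0 hUK hUrec hQ₀i hCQ.le hB hrate (by omega) (hlog T hT2)
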